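/- **Setting.** Let $M,N\in\mathbb{N}$, $\Lambda\in\mathbb{R}^{M\times N}$, $t\in\mathbb{R}^N$ with $t\neq 0$, and $\mathcal{H}=L^2(\mathbb{R}^M,\mathbb{C}^{2^N})$, where $\mathbb{C}^{2^N}=(\mathbb{C}^2)^{\otimes N}$ and the inner product $\langle\cdot,\cdot\rangle$ is conjugate-linear in its first argument. For $1\le n\le N$ and $a\in\{x,z\}$ let $\sigma_a^n=1\otimes\cdots\otimes\sigma_a\otimes\cdots\otimes 1$ with the Pauli matrix $\sigma_x=\begin{pmatrix}0&1\\1&0\end{pmatrix}$, respectively $\sigma_z=\begin{pmatrix}1&0\\0&-1\end{pmatrix}$, in the $n$-th slot. Put $(\Lambda\sigma_z)_m=\sum_n\Lambda_{mn}\sigma_z^n$, $x\cdot\Lambda\sigma_z=\sum_m x_m(\Lambda\sigma_z)_m$ and $t\cdot\sigma_x=\sum_n t_n\sigma_x^n$. Let $H_0=-\Delta+|x|^2+x\cdot\Lambda\sigma_z-t\cdot\sigma_x$; its form domain is $$Q_0=\{\psi\in\mathcal{H}:\ \nabla\psi\in L^2 \text{ (weak gradient)},\ |x|\psi\in L^2\},$$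 and its quadratic form on $Q_0$ is $$\langle\psi,H_0\psi\rangle=\|\nabla\psi\|^2+\|x\psi\|^2+\langle\psi,x\cdot\Lambda\sigma_z\psi\rangle-\langle\psi,t\cdot\sigma_x\psi\rangle .$$ For $\sigma\in[-1,1]^N$ and $\xi\in\mathbb{R}^M$ let $$\mathcal{M}_{\sigma,\xi}=\{\psi\in Q_0:\ \|\psi\|=1,\ \langle\psi,\sigma_z^n\psi\rangle=\sigma_n\ (1\le n\le N),\ \langle\psi,x_m\psi\rangle=\xi_m\ (1\le m\le M)\},$$ $$F_{\mathrm{LL}}(\sigma,\xi)=\inf_{\psi\in\mathcal{M}_{\sigma,\xi}}\langle\psi,H_0\psi\rangle .$$ An *optimizer* of $F_{\mathrm{LL}}(\sigma,\xi)$ is a $\psi\in\mathcal{M}_{\sigma,\xi}$ at which this infimum is attained; $\psi$ is *real-valued* if all its $2^N$ components are real almost everywhere. **Theorem 3.6 (Properties of $F_{\mathrm{LL}}$).** For every $(\sigma,\xi)\in[-1,1]^N\times\mathbb{R}^M$ the following hold. (i) (Displacement rule) For every $\zeta\in\mathbb{R}^M$, $$F_{\mathrm{LL}}(\sigma,\xi+\zeta)=F_{\mathrm{LL}}(\sigma,\xi)+2\zeta\cdot\xi+\zeta\cdot\Lambda\sigma+|\zeta|^2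 .$$ In particular, $F_{\mathrm{LL}}(\sigma,\xi)=F_{\mathrm{LL}}(\sigma,0)+\xi\cdot\Lambda\sigma+|\xi|^2$. (ii) There is a real-valued optimizer of $F_{\mathrm{LL}}(\sigma,\xi)$. (iii) (Virial relation) Every optimizer $\psi$ of $F_{\mathrm{LL}}(\sigma,0)$ satisfies $$\|\nabla\psi\|^2-\|x\psi\|^2=\tfrac12\langle\psi,x\cdot\Lambda\sigma_z\psi\rangle .$$ (iv) Every real-valued optimizer $\psi$ of $F_{\mathrm{LL}}(\sigma,\xi)$ satisfies $$\langle\psi,x\cdot\Lambda\sigma_z\psi\rangle=\xi\cdot\Lambda\sigma-\tfrac12\|\Lambda\sigma_z\psi\|^2+\tfrac12|\Lambda\sigma|^2-\langle t\cdot\sigma_x\psi,\ \nabla\cdot\Lambda(\sigma_z-\sigma)\psi\rangle ,$$ where $\|\Lambda\sigma_z\psi\|^2=\sum_m\|(\Lambda\sigma_z)_m\psi\|^2$ and $\nabla\cdot\Lambda(\sigma_z-\sigma)\psi=\sum_{m,n}\Lambda_{mn}(\sigma_z^n-\sigma_n)\,\partial_{x_m}\psi$. -/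

import Mathlib

open MeasureTheory
open scoped SchwartzMap LineDeriv

noncomputable section

namespace Dicke

/-- The configuration space `ℝ^M` of the `M` field modes, with the Euclidean structure. -/
abbrev Pos (M : ℕ) : Type := EuclideanSpace ℝ (Fin M)

/-- Multi-indices `α ∈ {+,-}^N`; the value `0` stands for `+` and the value `1` for `-`. -/
abbrev SpinIdx (N : ℕ) : Type := Fin N → Fin 2

/-- The spin space `ℂ^{2^N}` with its Euclidean inner product. -/
abbrev Spin (N : ℕ) : Type := EuclideanSpace ℂ (SpinIdx N)

/-- The Hilbert space `L²(ℝ^M, ℂ^{2^N})`, with inner product conjugate-linear in the first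
argument. -/
abbrev Hilb (M N : ℕ) : Type := Lp (Spin N) 2 (volume : Measure (Pos M))

/-- The Pauli matrix `σ_x`. -/
def pauliX : Matrix (Fin 2) (Fin 2) ℂ := !![0, 1; 1, 0]

/-- The Pauli matrix `σ_z`. -/
def pauliZ : Matrix (Fin 2) (Fin 2) ℂ := !![1, 0; 0, -1]

/-- The lifted matrix `1 ⊗ ⋯ ⊗ 1 ⊗ A ⊗ 1 ⊗ ⋯ ⊗ 1`, with `A` in the `n`-th slot. -/
def liftMatrix {N : ℕ} (A : Matrix (Fin 2) (Fin 2) ℂ) (n : Fin N) :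
    Matrix (SpinIdx N) (SpinIdx N) ℂ :=
  Matrix.of fun α β =>
    A (α n) (β n) * ∏ k ∈ Finset.univ.erase n, (1 : Matrix (Fin 2) (Fin 2) ℂ) (α k) (β k)

/-- A matrix on the spin space acting pointwise on wavefunctions. -/
def spinOp {M N : ℕ} (A : Matrix (SpinIdx N) (SpinIdx N) ℂ) : Hilb M N →L[ℂ] Hilb M N :=
  ContinuousLinearMap.compLpL 2 volume (Matrix.toEuclideanCLM (𝕜 := ℂ) A)

/-- The operator `σ_x^n` on wavefunctions. -/
def sigmaX {M N : ℕ} (n : Fin N) : Hilb M N →L[ℂ] Hilb M N := spinOp (liftMatrix pauliX n)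

/-- The operator `σ_z^n` on wavefunctions. -/
def sigmaZ {M N : ℕ} (n : Fin N) : Hilb M N →L[ℂ] Hilb M N := spinOp (liftMatrix pauliZ n)

/-- `φ ∈ L²` is the weak derivative `∂ψ/∂x_m`, in the sense of tempered distributions. -/
def IsWeakPartial {M N : ℕ} (m : Fin M) (ψ φ : Hilb M N) : Prop :=
  ∂_{(EuclideanSpace.single m (1 : ℝ) : Pos M)} (ψ : 𝓢'(Pos M, Spin N)) = (φ : 𝓢'(Pos M, Spin N))

theorem IsWeakPartial.unique {M N : ℕ} {m : Fin M} {ψ φ φ' : Hilb M N}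
    (h : IsWeakPartial m ψ φ) (h' : IsWeakPartial m ψ φ') : φ = φ' := by
  have hker := MeasureTheory.Lp.ker_toTemperedDistributionCLM_eq_bot
    (F := Spin N) (μ := (volume : Measure (Pos M))) (p := 2)
  exact LinearMap.ker_eq_bot.mp hker (h.symm.trans h')

/-- Integration-by-parts form of the definition of the weak derivative. -/
theorem isWeakPartial_iff {M N : ℕ} (m : Fin M) (ψ φ : Hilb M N) :
    IsWeakPartial m ψ φ ↔ ∀ η : 𝓢(Pos M, ℂ),
      ∫ x, (fderiv ℝ η x (EuclideanSpace.single m (1 : ℝ))) • ψ x = - ∫ x, η x • φ x := by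
  unfold IsWeakPartial
  constructor
  · intro h η
    have h1 := DFunLike.congr_fun h η
    simp only [TemperedDistribution.lineDerivOp_apply_apply, Lp.toTemperedDistribution_apply,
      neg_apply, neg_smul, integral_neg,
      SchwartzMap.lineDerivOp_apply_eq_fderiv] at h1
    rw [← h1, neg_neg]
  · intro h
    ext η
    simp only [TemperedDistribution.lineDerivOp_apply_apply, Lp.toTemperedDistribution_apply,
      neg_apply, neg_smul, integral_neg,
      SchwartzMap.lineDerivOp_apply_eq_fderiv]
    rw [h η, neg_neg]

open Classical in
/-- The weak derivative `∂_{x_m} ψ` if it exists in `L²` (and `0` otherwise). -/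
def partialD {M N : ℕ} (m : Fin M) (ψ : Hilb M N) : Hilb M N :=
  if h : ∃ φ : Hilb M N, IsWeakPartial m ψ φ then h.choose else 0

open Classical in
/-- The function `x_m ψ` if it belongs to `L²` (and `0` otherwise). -/
def position {M N : ℕ} (m : Fin M) (ψ : Hilb M N) : Hilb M N :=
  if h : MemLp (fun x : Pos M => ((x m : ℝ) : ℂ) • ψ x) 2 volume then h.toLp _ else 0

/-- The form domain `Q₀` of `H₀`: all `ψ ∈ L²` with weak gradient in `L²` and `|x| ψ ∈ L²`. -/
def formDomain (M N : ℕ) : Set (Hilb M N) :=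
  {ψ | ∀ m : Fin M, (∃ φ : Hilb M N, IsWeakPartial m ψ φ) ∧
    MemLp (fun x : Pos M => ((x m : ℝ) : ℂ) • ψ x) 2 volume}

/-- The `m`-th component `∑ₙ Λ_{mn} σ_z^n` of the vector `Λ σ_z`. -/
def lamSigmaZ {M N : ℕ} (Λ : Matrix (Fin M) (Fin N) ℝ) (m : Fin M) : Hilb M N →L[ℂ] Hilb M N :=
  ∑ n, (Λ m n : ℂ) • sigmaZ n

/-- `(x · Λ σ_z) ψ = ∑ₘ x_m (Λ σ_z)_m ψ`. -/
def coupling {M N : ℕ} (Λ : Matrix (Fin M) (Fin N) ℝ) (ψ : Hilb M N) : Hilb M N :=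
  ∑ m, lamSigmaZ Λ m (position m ψ)

/-- `t · σ_x = ∑ₙ t_n σ_x^n`. -/
def tSigmaX {M N : ℕ} (t : Fin N → ℝ) : Hilb M N →L[ℂ] Hilb M N :=
  ∑ n, (t n : ℂ) • sigmaX n

/-- `∇ · Λ (σ_z - σ) ψ = ∑ₘ ∑ₙ Λ_{mn} (σ_z^n - σ_n) ∂_{x_m} ψ`. -/
def divLamSigma {M N : ℕ} (Λ : Matrix (Fin M) (Fin N) ℝ) (σ : Fin N → ℝ) (ψ : Hilb M N) :
    Hilb M N :=
  ∑ m, ∑ n, (Λ m n : ℂ) • (sigmaZ n (partialD m ψ) - (σ n : ℂ) • partialD m ψ)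

/-- `‖∇ψ‖²`. -/
def gradNormSq {M N : ℕ} (ψ : Hilb M N) : ℝ := ∑ m, ‖partialD m ψ‖ ^ 2

/-- `‖xψ‖²`. -/
def posNormSq {M N : ℕ} (ψ : Hilb M N) : ℝ := ∑ m, ‖position m ψ‖ ^ 2

/-- `‖Λ σ_z ψ‖²`. -/
def lamSigmaZNormSq {M N : ℕ} (Λ : Matrix (Fin M) (Fin N) ℝ) (ψ : Hilb M N) : ℝ :=
  ∑ m, ‖lamSigmaZ Λ m ψ‖ ^ 2

/-- The quadratic form `⟨ψ, H₀ ψ⟩` on the form domain, where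
`H₀ = -Δ + |x|² + x · Λ σ_z - t · σ_x`. -/
def energy {M N : ℕ} (Λ : Matrix (Fin M) (Fin N) ℝ) (t : Fin N → ℝ) (ψ : Hilb M N) : ℝ :=
  gradNormSq ψ + posNormSq ψ + (inner ℂ ψ (coupling Λ ψ)).re - (inner ℂ ψ (tSigmaX t ψ)).re

/-- The magnetization `σ_ψ = ⟨ψ, σ_z ψ⟩`. -/
def magnetization {M N : ℕ} (ψ : Hilb M N) : Fin N → ℝ := fun n => (inner ℂ ψ (sigmaZ n ψ)).re

/-- The displacement `ξ_ψ = ⟨ψ, x ψ⟩` of a `ψ` in the form domain. -/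
def displacement {M N : ℕ} (ψ : Hilb M N) : Fin M → ℝ := fun m => (inner ℂ ψ (position m ψ)).re

/-- The set of normalized states with magnetization `σ` and displacement `ξ`. -/
def constraintSet {M N : ℕ} (σ : Fin N → ℝ) (ξ : Fin M → ℝ) : Set (Hilb M N) :=
  {ψ | ψ ∈ formDomain M N ∧ ‖ψ‖ = 1 ∧ magnetization ψ = σ ∧ displacement ψ = ξ}

/-- The Levy–Lieb functional: the infimum of `⟨ψ, H₀ ψ⟩` over the constraint set. -/
def FLL {M N : ℕ} (Λ : Matrix (Fin M) (Fin N) ℝ) (t : Fin N → ℝ) (σ : Fin N → ℝ)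
    (ξ : Fin M → ℝ) : ℝ :=
  sInf (energy Λ t '' constraintSet σ ξ)

/-- `ψ` attains the infimum defining the Levy–Lieb functional. It is stated as minimality over the
constraint set, so that an optimizer can only exist if the infimum is a genuine one. -/
def IsOptimizer {M N : ℕ} (Λ : Matrix (Fin M) (Fin N) ℝ) (t : Fin N → ℝ) (σ : Fin N → ℝ)
    (ξ : Fin M → ℝ) (ψ : Hilb M N) : Prop :=
  ψ ∈ constraintSet σ ξ ∧ ∀ φ ∈ constraintSet σ ξ, energy Λ t ψ ≤ energy Λ t φ

theorem IsOptimizer.FLL_eq {M N : ℕ} {Λ : Matrix (Fin M) (Fin N) ℝ} {t : Fin N → ℝ}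
    {σ : Fin N → ℝ} {ξ : Fin M → ℝ} {ψ : Hilb M N} (h : IsOptimizer Λ t σ ξ ψ) :
    FLL Λ t σ ξ = energy Λ t ψ :=
  IsLeast.csInf_eq ⟨⟨ψ, h.1, rfl⟩, by rintro _ ⟨φ, hφ, rfl⟩; exact h.2 φ hφ⟩

/-- `ψ` is real-valued: all its spin components are real almost everywhere. -/
def IsRealValued {M N : ℕ} (ψ : Hilb M N) : Prop := ∀ᵐ x : Pos M, ∀ α, (ψ x α).im = 0

end Dicke

end

open Dicke

/-! The three identities come from moving a state along a family on which the energy is explicit;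
the optimizer comes from the direct method.

Weak derivatives are handled through translations. `isWeakDeriv_iff_hasDerivAt` identifies the weak
derivative with minus the velocity of the translation orbit in L², and `exists_isWeakDeriv` produces
it, with its norm bound, from bounded difference quotients. So bounded real-linear maps that
intertwine translations act on derivatives (`IsWeakDeriv.map`), and 1-Lipschitz maps commuting with
translations do not increase their norms.

Split ψ into its 2^N spin components ψ_α. The magnetization depends only on the weights ‖ψ_α‖², the
displacement and the coupling only on the first moments of the components. Translating each ψ_α by
its own vector keeps the weights and the gradient norm, shifts the moments, and changes the energy
by an explicit quadratic plus the change of the t·σ_x term (`energy_spinTranslate`). A common vector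
for all α leaves that last term invariant, which gives the displacement rule. The vectors s Λ(s_α -
σ), with s_α the spin configuration of α, preserve the displacement, since the weighted mean of Λ
s_α is Λσ; stationarity at s = 0 gives the identity for real-valued optimizers
(`IsOptimizer.coupling_eq`). Dilations preserve the constraints when ξ = 0, and stationarity at r =
1 is the virial relation (`IsOptimizer.virial`).

For existence (`exists_isOptimizer`), Young's inequality bounds ∇ψ and xψ along a minimizing
sequence. Control of translations and tails gives L² compactness (`totallyBounded_of_norm_le`),
bounded xψ lets the moments pass to the limit, and the gradient and position norms are lower
semicontinuous. A bump times a product spin state shows that the constraints can be met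
(`constraintSet_nonempty`). Replacing components by their moduli, with signs adapted to t, makes an
optimizer real-valued without raising the energy (`energy_modulusWave_le`). -/

noncomputable section

namespace Dicke

open Filter Topology

/-! ### Translations on L² -/

section Translation

variable {M : ℕ} {E : Type*} [NormedAddCommGroup E] [NormedSpace ℂ E]

/-- Translation `(τ_a f)(x) = f (x - a)` on `L²`. -/
def translate (a : Pos M) :
    Lp E 2 (volume : Measure (Pos M)) →ₗᵢ[ℂ] Lp E 2 (volume : Measure (Pos M)) :=
  Lp.compMeasurePreservingₗᵢ ℂ (fun x => x - a) (measurePreserving_sub_right volume a)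

theorem coeFn_translate (a : Pos M) (f : Lp E 2 (volume : Measure (Pos M))) :
    translate a f =ᵐ[volume] fun x => f (x - a) :=
  Lp.coeFn_compMeasurePreserving f (measurePreserving_sub_right volume a)

theorem translate_zero (f : Lp E 2 (volume : Measure (Pos M))) : translate 0 f = f := by
  apply Lp.ext
  filter_upwards [coeFn_translate 0 f] with x hx
  simp [hx]

theorem translate_translate (a b : Pos M) (f : Lp E 2 (volume : Measure (Pos M))) :
    translate a (translate b f) = translate (a + b) f := by
  apply Lp.ext
  filter_upwards [coeFn_translate a (translate b f), coeFn_translate (a + b) f,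
    (measurePreserving_sub_right volume a).quasiMeasurePreserving.ae (coeFn_translate b f)]
    with x h1 h2 h3
  rw [h1, h2, h3, sub_sub]

theorem translate_neg_translate (a : Pos M) (f : Lp E 2 (volume : Measure (Pos M))) :
    translate (-a) (translate a f) = f := by
  rw [translate_translate, neg_add_cancel, translate_zero]

theorem continuous_translate (f : Lp E 2 (volume : Measure (Pos M))) :
    Continuous fun a : Pos M => translate a f := by
  have hc : Continuous fun p : Pos M × Pos M => p.2 - p.1 := by fun_prop
  exact Continuous.compMeasurePreservingLp (f := fun _ => f)
    (g := (ContinuousMap.mk _ hc).curry) continuous_const (ContinuousMap.continuous _)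
    (fun a => measurePreserving_sub_right volume a) (by norm_num)

end Translation

/-! ### Weak derivatives as generators of translations -/

variable {M N : ℕ}

/-- The pairing of an `L²` wavefunction with a Schwartz function, as a continuous linear map. -/
def schwartzPairing (η : 𝓢(Pos M, ℂ)) : Hilb M N →L[ℂ] Spin N :=
  (ContinuousLinearMap.lsmul ℂ ℂ (E := Spin N)).lpPairing volume 2 2 (η.toLp 2 volume)

theorem schwartzPairing_apply (η : 𝓢(Pos M, ℂ)) (ψ : Hilb M N) :
    schwartzPairing η ψ = ∫ x, η x • ψ x := by
  rw [schwartzPairing, ContinuousLinearMap.lpPairing_eq_integral]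
  apply integral_congr_ae
  filter_upwards [η.coeFn_toLp 2 volume] with x hx
  simp [hx]

theorem eq_zero_of_schwartzPairing {ψ : Hilb M N}
    (h : ∀ η : 𝓢(Pos M, ℂ), schwartzPairing η ψ = 0) : ψ = 0 := by
  have hker := MeasureTheory.Lp.ker_toTemperedDistributionCLM_eq_bot
    (F := Spin N) (μ := (volume : Measure (Pos M))) (p := 2)
  refine LinearMap.ker_eq_bot'.mp hker ψ ?_
  ext1 η
  simpa [schwartzPairing_apply] using h η

/-- `φ ∈ L²` is the weak derivative of `ψ` in the direction `v`. -/
def IsWeakDeriv (v : Pos M) (ψ φ : Hilb M N) : Prop :=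
  ∂_{v} (ψ : 𝓢'(Pos M, Spin N)) = (φ : 𝓢'(Pos M, Spin N))

theorem isWeakDeriv_iff (v : Pos M) (ψ φ : Hilb M N) :
    IsWeakDeriv v ψ φ ↔ ∀ η : 𝓢(Pos M, ℂ),
      schwartzPairing (∂_{v} η) ψ = - schwartzPairing η φ := by
  have key : ∀ η : 𝓢(Pos M, ℂ), (∂_{v} (ψ : 𝓢'(Pos M, Spin N))) η =
      - schwartzPairing (∂_{v} η) ψ := by
    intro η
    simp [schwartzPairing_apply, TemperedDistribution.lineDerivOp_apply_apply, integral_neg]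
  have key2 : ∀ η : 𝓢(Pos M, ℂ), (φ : 𝓢'(Pos M, Spin N)) η = schwartzPairing η φ := by
    intro η
    simp [schwartzPairing_apply]
  constructor
  · intro h η
    have h1 := DFunLike.congr_fun h η
    rw [key, key2] at h1
    rw [← h1, neg_neg]
  · intro h
    ext1 η
    rw [key, key2, h η, neg_neg]

theorem schwartzPairing_translate (η : 𝓢(Pos M, ℂ)) (a : Pos M) (ψ : Hilb M N) :
    schwartzPairing η (translate a ψ) = schwartzPairing (η.compSubConstCLM ℂ (-a)) ψ := by
  rw [schwartzPairing_apply, schwartzPairing_apply,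
    ← integral_sub_right_eq_self (fun x => (η.compSubConstCLM ℂ (-a)) x • ψ x) a]
  apply integral_congr_ae
  filter_upwards [coeFn_translate a ψ] with x hx
  simp [hx]

theorem lineDerivOp_compSubConstCLM (η : 𝓢(Pos M, ℂ)) (v a : Pos M) :
    ∂_{v} (η.compSubConstCLM ℂ a) = (∂_{v} η).compSubConstCLM ℂ a := by
  ext x
  simp only [SchwartzMap.compSubConstCLM_apply, SchwartzMap.lineDerivOp_apply_eq_fderiv]
  have : ((η.compSubConstCLM ℂ a : 𝓢(Pos M, ℂ)) : Pos M → ℂ) = fun x => η (x - a) := rfl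
  rw [this, fderiv_comp_sub]

/-- Schwartz decay survives bounded shifts, uniformly in the shift. The power M + 1 makes the
majorant square integrable on ℝ^M, which is what differentiation under an integral against an L²
function requires. -/
theorem exists_schwartz_bound (g : 𝓢(Pos M, ℂ)) (v : Pos M) :
    ∃ C : ℝ, ∀ s : ℝ, |s| ≤ 1 → ∀ x, ‖g (x + s • v)‖ ≤ C * (1 + ‖x‖) ^ (-((M : ℝ) + 1)) := by
  obtain ⟨C, hC⟩ : ∃ C : ℝ, ∀ x, (1 + ‖x‖) ^ (M + 1) * ‖g x‖ ≤ C := by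
    refine ⟨2 ^ (M + 1) * (Finset.Iic (M + 1, 0)).sup
      (fun m => SchwartzMap.seminorm ℂ m.1 m.2) g, fun x => ?_⟩
    have := SchwartzMap.one_add_le_sup_seminorm_apply (𝕜 := ℂ) (m := (M + 1, 0)) le_rfl le_rfl g x
    simpa only [norm_iteratedFDeriv_zero] using this
  refine ⟨(1 + ‖v‖) ^ (M + 1) * C, fun s hs x => ?_⟩
  -- Peetre's inequality transfers the decay from the shifted point to x, at the cost of a factor
  -- depending only on v.
  have h1 : (1 + ‖x‖) ≤ (1 + ‖v‖) * (1 + ‖x + s • v‖) := by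
    have h2 : ‖x‖ ≤ ‖x + s • v‖ + ‖v‖ := by
      calc ‖x‖ = ‖(x + s • v) - s • v‖ := by simp
        _ ≤ ‖x + s • v‖ + ‖s • v‖ := norm_sub_le _ _
        _ ≤ _ := by
          gcongr
          rw [norm_smul]
          exact mul_le_of_le_one_left (norm_nonneg _) hs
    nlinarith [norm_nonneg v, norm_nonneg (x + s • v)]
  have h0 : 0 < 1 + ‖x‖ := by positivity
  rw [Real.rpow_neg h0.le, ← div_eq_mul_inv, le_div_iff₀ (by positivity)]
  have : (1 + ‖x‖) ^ ((M : ℝ) + 1) = (1 + ‖x‖) ^ (M + 1) := by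
    rw [← Real.rpow_natCast]; push_cast; rfl
  rw [this]
  calc ‖g (x + s • v)‖ * (1 + ‖x‖) ^ (M + 1)
      ≤ ‖g (x + s • v)‖ * ((1 + ‖v‖) * (1 + ‖x + s • v‖)) ^ (M + 1) := by gcongr
    _ = (1 + ‖v‖) ^ (M + 1) * ((1 + ‖x + s • v‖) ^ (M + 1) * ‖g (x + s • v)‖) := by
        rw [mul_pow]; ring
    _ ≤ _ := by gcongr; exact hC _

theorem memLp_one_add_norm_rpow :
    MemLp (fun x : Pos M => (1 + ‖x‖) ^ (-((M : ℝ) + 1))) 2 volume := by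
  have hc : Continuous fun x : Pos M => (1 + ‖x‖) ^ (-((M : ℝ) + 1)) := by
    refine Continuous.rpow_const (by fun_prop) fun x => Or.inl ?_
    positivity
  rw [memLp_two_iff_integrable_sq hc.aestronglyMeasurable]
  have : (fun x : Pos M => ((1 + ‖x‖) ^ (-((M : ℝ) + 1))) ^ 2) =
      fun x => (1 + ‖x‖) ^ (-(2 * ((M : ℝ) + 1))) := by
    ext x
    have h0 : 0 ≤ 1 + ‖x‖ := by positivity
    rw [← Real.rpow_natCast, ← Real.rpow_mul h0]
    congr 1
    push_cast
    ring
  rw [this]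
  refine integrable_one_add_norm ?_
  rw [finrank_euclideanSpace_fin]
  have : (0 : ℝ) ≤ M := by positivity
  linarith

/-- A change of variables puts the translation on η, which is smooth; dominated differentiation then
applies, the majorant being a product of two L² functions. -/
theorem hasDerivAt_schwartzPairing_translate_zero (η : 𝓢(Pos M, ℂ)) (v : Pos M) (ψ : Hilb M N) :
    HasDerivAt (fun s : ℝ => schwartzPairing η (translate (s • v) ψ))
      (schwartzPairing (∂_{v} η) ψ) 0 := by
  obtain ⟨C, hC⟩ := exists_schwartz_bound (∂_{v} η) v
  have heq : (fun s : ℝ => schwartzPairing η (translate (s • v) ψ)) =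
      fun s : ℝ => ∫ x, η (x + s • v) • ψ x := by
    ext1 s
    rw [schwartzPairing_translate, schwartzPairing_apply]
    simp
  rw [heq, schwartzPairing_apply]
  have hψ := Lp.memLp ψ
  have hint : Integrable (fun x => (C * (1 + ‖x‖) ^ (-((M : ℝ) + 1))) * ‖ψ x‖) := by
    have := (memLp_one_add_norm_rpow (M := M)).integrable_mul hψ.norm
    simpa [mul_assoc] using this.const_mul C
  have hmeas : ∀ (g : 𝓢(Pos M, ℂ)) (s : ℝ),
      AEStronglyMeasurable (fun x => g (x + s • v) • ψ x) volume := by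
    intro g s
    have hc : Continuous fun x : Pos M => g (x + s • v) := g.continuous.comp (by fun_prop)
    have hc' : AEStronglyMeasurable (fun x : Pos M => g (x + s • v)) volume :=
      hc.aestronglyMeasurable
    exact hc'.smul hψ.1
  have := hasDerivAt_integral_of_dominated_loc_of_deriv_le (μ := volume) (𝕜 := ℝ)
    (F := fun (s : ℝ) x => η (x + s • v) • ψ x)
    (F' := fun (s : ℝ) x => (∂_{v} η) (x + s • v) • ψ x) (x₀ := 0)
    (bound := fun x => (C * (1 + ‖x‖) ^ (-((M : ℝ) + 1))) * ‖ψ x‖)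
    (s := Metric.ball 0 1) (Metric.ball_mem_nhds 0 one_pos)
    (Eventually.of_forall (hmeas η)) ?_ (hmeas _ 0) ?_ hint ?_
  · simpa using this.2
  · have h2 : MemLp (fun x => η x • ψ x) 1 volume := hψ.smul (η.memLp 2 volume)
    simpa using memLp_one_iff_integrable.mp h2
  · refine Eventually.of_forall fun x s hs => ?_
    rw [norm_smul]
    gcongr
    exact hC s (by simpa using (Metric.mem_ball.mp hs).le) x
  · refine Eventually.of_forall fun x s _ => ?_
    refine HasDerivAt.smul_const ?_ _
    rw [SchwartzMap.lineDerivOp_apply_eq_fderiv]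
    have h1 : HasFDerivAt η (fderiv ℝ η (x + s • v)) (x + s • v) :=
      η.differentiableAt.hasFDerivAt
    refine h1.comp_hasDerivAt s ?_
    simpa using ((hasDerivAt_id s).smul_const v).const_add x

theorem hasDerivAt_schwartzPairing_translate (η : 𝓢(Pos M, ℂ)) (v : Pos M) (ψ : Hilb M N) (s : ℝ) :
    HasDerivAt (fun s : ℝ => schwartzPairing η (translate (s • v) ψ))
      (schwartzPairing (∂_{v} η) (translate (s • v) ψ)) s := by
  have h := hasDerivAt_schwartzPairing_translate_zero η v (translate (s • v) ψ)
  have h2 : HasDerivAt (fun u : ℝ => u - s) 1 s := (hasDerivAt_id s).sub_const s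
  have h3 := HasDerivAt.scomp_of_eq (h := fun u : ℝ => u - s) s h h2 (by simp)
  rw [one_smul] at h3
  refine h3.congr_of_eventuallyEq (Eventually.of_forall fun u => ?_)
  simp only [Function.comp, translate_translate, sub_smul, sub_add_cancel]

theorem IsWeakDeriv.translate {v : Pos M} {ψ φ : Hilb M N} (h : IsWeakDeriv v ψ φ) (a : Pos M) :
    IsWeakDeriv v (translate a ψ) (translate a φ) := by
  rw [isWeakDeriv_iff] at h ⊢
  intro η
  rw [schwartzPairing_translate, schwartzPairing_translate, ← h, lineDerivOp_compSubConstCLM]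

/-- The fundamental theorem of calculus holds after pairing with each Schwartz function, and these
pairings separate points of L². -/
theorem IsWeakDeriv.translate_sub_eq_integral {v : Pos M} {ψ φ : Hilb M N}
    (h : IsWeakDeriv v ψ φ) (s : ℝ) :
    Dicke.translate (s • v) ψ - ψ = - ∫ u in (0 : ℝ)..s, Dicke.translate (u • v) φ := by
  have hcont : Continuous fun u : ℝ => Dicke.translate (u • v) φ :=
    (continuous_translate φ).comp (by fun_prop)
  rw [← sub_eq_zero, sub_neg_eq_add]
  apply eq_zero_of_schwartzPairing
  intro η
  rw [map_add, map_sub, ← ContinuousLinearMap.intervalIntegral_comp_comm _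
    (hcont.intervalIntegrable _ _)]
  have hd : ∀ u ∈ Set.uIcc 0 s, HasDerivAt
      (fun s : ℝ => schwartzPairing η (Dicke.translate (s • v) ψ))
      (- schwartzPairing η (Dicke.translate (u • v) φ)) u := by
    intro u _
    rw [← (isWeakDeriv_iff _ _ _).mp (h.translate (u • v)) η]
    exact hasDerivAt_schwartzPairing_translate η v ψ u
  have := intervalIntegral.integral_eq_sub_of_hasDerivAt hd
    ((((schwartzPairing η).continuous.comp hcont).neg).intervalIntegrable 0 s)
  rw [intervalIntegral.integral_neg] at this
  simp only [zero_smul, translate_zero] at this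
  rw [← this, neg_add_cancel]

/-- The weak derivative is the generator of translations. -/
theorem isWeakDeriv_iff_hasDerivAt (v : Pos M) (ψ φ : Hilb M N) :
    IsWeakDeriv v ψ φ ↔ HasDerivAt (fun s : ℝ => translate (s • v) ψ) (-φ) 0 := by
  constructor
  · intro h
    have hcont : Continuous fun u : ℝ => Dicke.translate (u • v) φ :=
      (continuous_translate φ).comp (by fun_prop)
    -- The orbit is a primitive of an L²-valued function that is continuous because translations act
    -- continuously on L².
    have h1 : (fun s : ℝ => Dicke.translate (s • v) ψ) =
        fun s => ψ - ∫ u in (0 : ℝ)..s, Dicke.translate (u • v) φ := by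
      ext1 s
      rw [sub_eq_add_neg, ← h.translate_sub_eq_integral, add_sub_cancel]
    rw [h1]
    have := intervalIntegral.integral_hasDerivAt_right (a := 0) (b := 0)
      (hcont.intervalIntegrable _ _) (hcont.stronglyMeasurableAtFilter _ _) hcont.continuousAt
    simpa [translate_zero] using this.const_sub ψ
  · intro h
    rw [isWeakDeriv_iff]
    intro η
    -- Norm differentiability passes to every pairing, where the derivative is already known; its
    -- uniqueness is the weak identity.
    have h1 := (schwartzPairing (N := N) η).restrictScalars ℝ |>.hasFDerivAt.comp_hasDerivAt 0 h
    have h2 := hasDerivAt_schwartzPairing_translate_zero η v ψ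
    simpa using h2.unique h1

theorem IsWeakDeriv.norm_translate_sub_le {v : Pos M} {ψ φ : Hilb M N}
    (h : IsWeakDeriv v ψ φ) (s : ℝ) : ‖Dicke.translate (s • v) ψ - ψ‖ ≤ ‖φ‖ * |s| := by
  rw [h.translate_sub_eq_integral, norm_neg]
  simpa using intervalIntegral.norm_integral_le_of_norm_le_const (a := 0) (b := s)
    (f := fun u : ℝ => Dicke.translate (u • v) φ) (C := ‖φ‖)
    fun u _ => ((Dicke.translate (u • v)).norm_map φ).le

theorem IsWeakDeriv.unique {v : Pos M} {ψ φ φ' : Hilb M N}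
    (h : IsWeakDeriv v ψ φ) (h' : IsWeakDeriv v ψ φ') : φ = φ' := by
  rw [isWeakDeriv_iff_hasDerivAt] at h h'
  exact neg_injective (h.unique h')

/-- A bounded map carries one orbit to the other, hence velocity to velocity. Only real linearity is
asked, so that complex conjugation qualifies, and the two directions may differ, as dilations
require. -/
theorem IsWeakDeriv.map {v : Pos M} {ψ φ : Hilb M N} (h : IsWeakDeriv v ψ φ) {v' : Pos M}
    (L : Hilb M N →L[ℝ] Hilb M N)
    (hL : ∀ (s : ℝ) (χ : Hilb M N),
      L (Dicke.translate (s • v) χ) = Dicke.translate (s • v') (L χ)) :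
    IsWeakDeriv v' (L ψ) (L φ) := by
  rw [isWeakDeriv_iff_hasDerivAt] at h ⊢
  have h1 := L.hasFDerivAt.comp_hasDerivAt 0 h
  simpa [Function.comp_def, hL] using h1

theorem IsWeakDeriv.const_smul {v : Pos M} {ψ φ : Hilb M N} (h : IsWeakDeriv v ψ φ) (c : ℂ) :
    IsWeakDeriv v (c • ψ) (c • φ) := by
  rw [isWeakDeriv_iff] at h ⊢
  intro η
  rw [map_smul, map_smul, h, smul_neg]

theorem IsWeakDeriv.sum {ι : Type*} (s : Finset ι) {v : Pos M} {ψ φ : ι → Hilb M N}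
    (h : ∀ i ∈ s, IsWeakDeriv v (ψ i) (φ i)) :
    IsWeakDeriv v (∑ i ∈ s, ψ i) (∑ i ∈ s, φ i) := by
  rw [isWeakDeriv_iff]
  intro η
  rw [map_sum, map_sum, ← Finset.sum_neg_distrib]
  exact Finset.sum_congr rfl fun i hi => (isWeakDeriv_iff _ _ _).mp (h i hi) η

theorem isWeakDeriv_of_isWeakPartial {ψ : Hilb M N} {φ : Fin M → Hilb M N}
    (h : ∀ m, IsWeakPartial m ψ (φ m)) (v : Pos M) :
    IsWeakDeriv v ψ (∑ m, (v m : ℂ) • φ m) := by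
  rw [isWeakDeriv_iff]
  intro η
  have hv : v = ∑ m, v m • EuclideanSpace.single m (1 : ℝ) := by
    ext i
    simp [Finset.sum_apply, Pi.single_apply]
  have h1 : ∂_{v} η = ∑ m, (v m : ℂ) • ∂_{(EuclideanSpace.single m (1 : ℝ) : Pos M)} η := by
    ext x
    simp only [SchwartzMap.lineDerivOp_apply_eq_fderiv, sum_apply,
      smul_apply]
    conv_lhs => rw [hv]
    simp
  rw [h1, map_sum, ← Finset.sum_neg_distrib]
  have h2 : ∀ (c : ℂ) (θ : 𝓢(Pos M, ℂ)),
      schwartzPairing (c • θ) ψ = c • schwartzPairing θ ψ := by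
    intro c θ
    rw [schwartzPairing_apply, schwartzPairing_apply, ← integral_smul]
    simp [smul_smul]
  have h3 : schwartzPairing (∑ m, (v m : ℂ) • ∂_{(EuclideanSpace.single m (1 : ℝ) : Pos M)} η) ψ =
      ∑ m, (v m : ℂ) • schwartzPairing (∂_{(EuclideanSpace.single m (1 : ℝ) : Pos M)} η) ψ := by
    simp only [← h2]
    simp only [schwartzPairing, map_sum, ← SchwartzMap.toLpCLM_apply (𝕜 := ℂ)]
    simp
  rw [h3]
  refine Finset.sum_congr rfl fun m _ => ?_
  rw [map_smul, (isWeakDeriv_iff _ _ _).mp (h m : IsWeakDeriv _ _ _) η, smul_neg]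

/-! ### Multiplication by coordinates and the form domain -/

theorem partialD_eq {m : Fin M} {ψ φ : Hilb M N} (h : IsWeakPartial m ψ φ) :
    partialD m ψ = φ := by
  have hex : ∃ φ : Hilb M N, IsWeakPartial m ψ φ := ⟨φ, h⟩
  rw [partialD, dif_pos hex]
  exact hex.choose_spec.unique h

/-- `φ ∈ L²` is the product `x_m ψ`. -/
def IsPosition (m : Fin M) (ψ φ : Hilb M N) : Prop :=
  φ =ᵐ[volume] fun x => ((x m : ℝ) : ℂ) • ψ x

theorem IsPosition.memLp {m : Fin M} {ψ φ : Hilb M N} (h : IsPosition m ψ φ) :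
    MemLp (fun x : Pos M => ((x m : ℝ) : ℂ) • ψ x) 2 volume :=
  (memLp_congr_ae h).mp (Lp.memLp φ)

theorem position_eq {m : Fin M} {ψ φ : Hilb M N} (h : IsPosition m ψ φ) :
    position m ψ = φ := by
  rw [position, dif_pos h.memLp]
  apply Lp.ext
  exact (MemLp.coeFn_toLp _).trans h.symm

theorem mem_formDomain_of {ψ : Hilb M N} (h : ∀ m, (∃ φ, IsWeakPartial m ψ φ) ∧
    ∃ φ, IsPosition m ψ φ) : ψ ∈ formDomain M N :=
  fun m => ⟨(h m).1, (h m).2.choose_spec.memLp⟩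

theorem isWeakPartial_partialD {ψ : Hilb M N} (h : ψ ∈ formDomain M N) (m : Fin M) :
    IsWeakPartial m ψ (partialD m ψ) := by
  obtain ⟨φ, hφ⟩ := (h m).1
  rwa [partialD_eq hφ]

theorem isPosition_position {ψ : Hilb M N} (h : ψ ∈ formDomain M N) (m : Fin M) :
    IsPosition m ψ (position m ψ) := by
  rw [IsPosition, position, dif_pos (h m).2]
  exact MemLp.coeFn_toLp _

theorem IsPosition.add {m : Fin M} {ψ φ ψ' φ' : Hilb M N} (h : IsPosition m ψ φ)
    (h' : IsPosition m ψ' φ') : IsPosition m (ψ + ψ') (φ + φ') := by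
  unfold IsPosition at *
  filter_upwards [h, h', Lp.coeFn_add ψ ψ', Lp.coeFn_add φ φ'] with x h1 h2 h3 h4
  rw [h4, h3, Pi.add_apply, Pi.add_apply, h1, h2, smul_add]

theorem IsPosition.const_smul {m : Fin M} {ψ φ : Hilb M N} (h : IsPosition m ψ φ) (c : ℂ) :
    IsPosition m (c • ψ) (c • φ) := by
  unfold IsPosition at *
  filter_upwards [h, Lp.coeFn_smul c ψ, Lp.coeFn_smul c φ] with x h1 h3 h4
  rw [h4, h3, Pi.smul_apply, Pi.smul_apply, h1, smul_comm]

theorem isPosition_zero (m : Fin M) : IsPosition m (0 : Hilb M N) 0 := by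
  unfold IsPosition
  exact Eventually.of_forall fun x => by simp

theorem IsPosition.sum {ι : Type*} (s : Finset ι) {m : Fin M} {ψ φ : ι → Hilb M N}
    (h : ∀ i ∈ s, IsPosition m (ψ i) (φ i)) :
    IsPosition m (∑ i ∈ s, ψ i) (∑ i ∈ s, φ i) := by
  classical
  induction s using Finset.induction_on with
  | empty => simpa using isPosition_zero m
  | insert a s ha ih =>
    rw [Finset.sum_insert ha, Finset.sum_insert ha]
    exact (h a (by simp)).add (ih fun i hi => h i (by simp [hi]))

theorem IsPosition.translate {m : Fin M} {ψ φ : Hilb M N} (h : IsPosition m ψ φ) (a : Pos M) :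
    IsPosition m (translate a ψ) (translate a φ + (a m : ℂ) • translate a ψ) := by
  unfold IsPosition at *
  filter_upwards [coeFn_translate a ψ, coeFn_translate a φ,
    (measurePreserving_sub_right volume a).quasiMeasurePreserving.ae h,
    Lp.coeFn_add (Dicke.translate a φ) ((a m : ℂ) • Dicke.translate a ψ),
    Lp.coeFn_smul (a m : ℂ) (Dicke.translate a ψ)] with x h1 h2 h3 h4 h5
  rw [h4, Pi.add_apply, h5, Pi.smul_apply, h1, h2, h3, ← add_smul]
  simp

theorem IsPosition.inner_comm {m : Fin M} {ψ φ ψ' φ' : Hilb M N} (h : IsPosition m ψ φ)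
    (h' : IsPosition m ψ' φ') : inner ℂ φ ψ' = inner ℂ ψ φ' := by
  rw [L2.inner_def, L2.inner_def]
  apply integral_congr_ae
  unfold IsPosition at h h'
  filter_upwards [h, h'] with x h1 h2
  rw [h1, h2, inner_smul_left, inner_smul_right]
  simp

theorem IsPosition.inner_im {m : Fin M} {ψ φ : Hilb M N} (h : IsPosition m ψ φ) :
    (inner ℂ ψ φ : ℂ).im = 0 := by
  have h1 := h.inner_comm h
  rw [← inner_conj_symm] at h1
  exact Complex.conj_eq_iff_im.mp h1

/-! ### Spin matrices acting on wavefunctions -/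

section SpinOp

variable (A B : Matrix (SpinIdx N) (SpinIdx N) ℂ)

theorem coeFn_spinOp (ψ : Hilb M N) :
    spinOp A ψ =ᵐ[volume] fun x => Matrix.toEuclideanCLM (𝕜 := ℂ) A (ψ x) :=
  ContinuousLinearMap.coeFn_compLpL _ ψ

theorem spinOp_mul (ψ : Hilb M N) : spinOp (A * B) ψ = spinOp A (spinOp B ψ) := by
  apply Lp.ext
  filter_upwards [coeFn_spinOp (A * B) ψ, coeFn_spinOp A (spinOp B ψ), coeFn_spinOp B ψ]
    with x h1 h2 h3
  rw [h1, h2, h3, map_mul]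
  rfl

theorem spinOp_one (ψ : Hilb M N) : spinOp 1 ψ = ψ := by
  apply Lp.ext
  filter_upwards [coeFn_spinOp 1 ψ] with x h1
  rw [h1, map_one]
  rfl

theorem spinOp_add : (spinOp (A + B) : Hilb M N →L[ℂ] Hilb M N) = spinOp A + spinOp B := by
  ext1 ψ
  apply Lp.ext
  filter_upwards [coeFn_spinOp (A + B) ψ, coeFn_spinOp A ψ, coeFn_spinOp B ψ,
    Lp.coeFn_add (spinOp A ψ) (spinOp B ψ)] with x h1 h2 h3 h4
  rw [h1, add_apply, h4, Pi.add_apply, h2, h3, map_add]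
  rfl

theorem spinOp_smul (c : ℂ) : (spinOp (c • A) : Hilb M N →L[ℂ] Hilb M N) = c • spinOp A := by
  ext1 ψ
  apply Lp.ext
  filter_upwards [coeFn_spinOp (c • A) ψ, coeFn_spinOp A ψ, Lp.coeFn_smul c (spinOp A ψ)]
    with x h1 h2 h4
  rw [h1, smul_apply, h4, Pi.smul_apply, h2, map_smul]
  rfl

theorem spinOp_sum {ι : Type*} (s : Finset ι) (A : ι → Matrix (SpinIdx N) (SpinIdx N) ℂ) :
    (spinOp (∑ i ∈ s, A i) : Hilb M N →L[ℂ] Hilb M N) = ∑ i ∈ s, spinOp (A i) :=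
  map_sum (⟨⟨spinOp, by simpa using spinOp_smul (0 : Matrix (SpinIdx N) (SpinIdx N) ℂ) 0⟩,
    spinOp_add⟩ : Matrix (SpinIdx N) (SpinIdx N) ℂ →+ (Hilb M N →L[ℂ] Hilb M N)) A s

theorem inner_spinOp (φ ψ : Hilb M N) :
    inner ℂ φ (spinOp A ψ) = inner ℂ (spinOp A.conjTranspose φ) ψ := by
  rw [L2.inner_def, L2.inner_def]
  apply integral_congr_ae
  filter_upwards [coeFn_spinOp A ψ, coeFn_spinOp A.conjTranspose φ] with x h1 h2
  rw [h1, h2, ← Matrix.star_eq_conjTranspose, map_star, ContinuousLinearMap.star_eq_adjoint,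
    ContinuousLinearMap.adjoint_inner_left]

theorem spinOp_translate (a : Pos M) (ψ : Hilb M N) :
    spinOp A (translate a ψ) = translate a (spinOp A ψ) := by
  apply Lp.ext
  filter_upwards [coeFn_spinOp A (translate a ψ), coeFn_translate a ψ,
    coeFn_translate a (spinOp A ψ),
    (measurePreserving_sub_right volume a).quasiMeasurePreserving.ae (coeFn_spinOp A ψ)]
    with x h1 h2 h3 h4
  rw [h1, h2, h3, h4]

variable {A B}

theorem IsPosition.spinOp {m : Fin M} {ψ φ : Hilb M N} (h : IsPosition m ψ φ)
    (A : Matrix (SpinIdx N) (SpinIdx N) ℂ) : IsPosition m (spinOp A ψ) (spinOp A φ) := by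
  unfold IsPosition at *
  filter_upwards [coeFn_spinOp A ψ, coeFn_spinOp A φ, h] with x h1 h2 h3
  rw [h1, h2, h3, map_smul]

theorem IsWeakDeriv.spinOp {v : Pos M} {ψ φ : Hilb M N} (h : IsWeakDeriv v ψ φ)
    (A : Matrix (SpinIdx N) (SpinIdx N) ℂ) : IsWeakDeriv v (spinOp A ψ) (spinOp A φ) :=
  h.map ((Dicke.spinOp A).restrictScalars ℝ) fun s χ => spinOp_translate A (s • v) χ

end SpinOp

/-! ### Pauli matrices and spin components -/

section Components

/-- The eigenvalues `±1` of `σ_z`. -/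
def spinSign (i : Fin 2) : ℝ := if i = 0 then 1 else -1

theorem spinSign_mul_self (i : Fin 2) : spinSign i * spinSign i = 1 := by
  unfold spinSign; split_ifs <;> norm_num

theorem prod_erase_one_apply (n : Fin N) (α β : SpinIdx N) :
    ∏ k ∈ Finset.univ.erase n, (1 : Matrix (Fin 2) (Fin 2) ℂ) (α k) (β k) =
      if ∀ k, k ≠ n → α k = β k then 1 else 0 := by
  split_ifs with h
  · refine Finset.prod_eq_one fun k hk => ?_
    rw [h k (Finset.ne_of_mem_erase hk), Matrix.one_apply_eq]
  · push Not at h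
    obtain ⟨k, hk, hne⟩ := h
    exact Finset.prod_eq_zero (Finset.mem_erase.mpr ⟨hk, Finset.mem_univ _⟩)
      (Matrix.one_apply_ne hne)

theorem liftMatrix_pauliZ (n : Fin N) :
    liftMatrix pauliZ n = Matrix.diagonal fun α : SpinIdx N => (spinSign (α n) : ℂ) := by
  ext α β
  rw [liftMatrix, Matrix.of_apply, prod_erase_one_apply, Matrix.diagonal_apply]
  by_cases hαβ : α = β
  · subst hαβ
    have : ∀ i : Fin 2, pauliZ i i = (spinSign i : ℂ) := by
      intro i; fin_cases i <;> simp [pauliZ, spinSign]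
    simp [this]
  · rw [if_neg hαβ]
    by_cases h : ∀ k, k ≠ n → α k = β k
    · have hn : α n ≠ β n := by
        intro hn
        refine hαβ (funext fun k => ?_)
        by_cases hk : k = n
        · rw [hk, hn]
        · exact h k hk
      have : ∀ i j : Fin 2, i ≠ j → pauliZ i j = 0 := by
        intro i j; fin_cases i <;> fin_cases j <;> simp [pauliZ]
      rw [this _ _ hn, zero_mul]
    · rw [if_neg h, mul_zero]

/-- The index obtained from `α` by flipping the `n`-th spin. -/
def flipSpin (n : Fin N) (α : SpinIdx N) : SpinIdx N := Function.update α n (1 - α n)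

theorem flipSpin_flipSpin (n : Fin N) (α : SpinIdx N) : flipSpin n (flipSpin n α) = α := by
  simp [flipSpin]

theorem liftMatrix_pauliX (n : Fin N) (α β : SpinIdx N) :
    liftMatrix pauliX n α β = if β = flipSpin n α then 1 else 0 := by
  rw [liftMatrix, Matrix.of_apply, prod_erase_one_apply]
  have hx : ∀ i j : Fin 2, pauliX i j = if j = 1 - i then 1 else 0 := by
    intro i j; fin_cases i <;> fin_cases j <;> simp [pauliX]
  have hiff : β = flipSpin n α ↔ (β n = 1 - α n ∧ ∀ k, k ≠ n → α k = β k) := by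
    rw [flipSpin, Function.eq_update_iff]
    simp only [ne_eq, eq_comm]
  rw [hx]
  simp only [hiff]
  split_ifs <;> simp_all

theorem toEuclideanCLM_liftMatrix_pauliX (n : Fin N) (c : Spin N) (α : SpinIdx N) :
    Matrix.toEuclideanCLM (𝕜 := ℂ) (liftMatrix pauliX n) c α = c (flipSpin n α) := by
  rw [Matrix.ofLp_toEuclideanCLM, Matrix.mulVec, dotProduct]
  simp [liftMatrix_pauliX]

theorem toEuclideanCLM_diagonal (d : SpinIdx N → ℂ) (c : Spin N) (α : SpinIdx N) :
    Matrix.toEuclideanCLM (𝕜 := ℂ) (Matrix.diagonal d) c α = d α * c α := by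
  rw [Matrix.ofLp_toEuclideanCLM, Matrix.mulVec_diagonal]

/-- The orthogonal projection onto the spin component `α`. -/
def component (α : SpinIdx N) : Hilb M N →L[ℂ] Hilb M N :=
  spinOp (Matrix.diagonal (Pi.single α 1))

theorem spinOp_diagonal (d : SpinIdx N → ℂ) (ψ : Hilb M N) :
    spinOp (Matrix.diagonal d) ψ = ∑ α, d α • component α ψ := by
  have h : Matrix.diagonal d =
      ∑ α, d α • (Matrix.diagonal (Pi.single α 1) : Matrix (SpinIdx N) (SpinIdx N) ℂ) := by
    ext β γ
    simp [Matrix.sum_apply, Matrix.diagonal_apply, Pi.single_apply]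
  rw [h, spinOp_sum]
  simp [spinOp_smul, component]

theorem sum_component (ψ : Hilb M N) : ∑ α, component α ψ = ψ := by
  have := spinOp_diagonal (fun _ : SpinIdx N => (1 : ℂ)) ψ
  simp only [one_smul] at this
  rw [← this, Matrix.diagonal_one, spinOp_one]

theorem component_component (α β : SpinIdx N) (ψ : Hilb M N) :
    component α (component β ψ) = if α = β then component β ψ else 0 := by
  unfold component
  rw [← spinOp_mul, Matrix.diagonal_mul_diagonal]
  split_ifs with h
  · subst h
    congr 3
    ext γ
    simp [Pi.single_apply]
  · have : (fun γ => (Pi.single α 1 : SpinIdx N → ℂ) γ *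
        (Pi.single β 1 : SpinIdx N → ℂ) γ) = 0 := by
      ext γ
      by_cases h1 : γ = α
      · subst h1; simp [h]
      · simp [h1]
    rw [this]
    have h0 := spinOp_smul (M := M) (0 : Matrix (SpinIdx N) (SpinIdx N) ℂ) 0
    rw [zero_smul, zero_smul] at h0
    simp [Matrix.diagonal_zero', h0]

theorem component_sum_smul (d : SpinIdx N → ℂ) (α : SpinIdx N) (ψ : Hilb M N) :
    component α (∑ β, d β • component β ψ) = d α • component α ψ := by
  rw [map_sum]
  simp only [map_smul, component_component, smul_ite, smul_zero, Finset.sum_ite_eq,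
    Finset.mem_univ, if_true]

theorem inner_component_comm (α : SpinIdx N) (φ ψ : Hilb M N) :
    inner ℂ φ (component α ψ) = inner ℂ (component α φ) ψ := by
  unfold component
  rw [inner_spinOp, Matrix.diagonal_conjTranspose]
  congr 4
  ext γ
  by_cases h : γ = α <;> simp [h]

theorem inner_component_component (α : SpinIdx N) (φ ψ : Hilb M N) :
    inner ℂ (component α φ) (component α ψ) = inner ℂ φ (component α ψ) := by
  rw [← inner_component_comm, component_component, if_pos rfl]

theorem inner_spinOp_diagonal (d : SpinIdx N → ℂ) (φ ψ : Hilb M N) :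
    inner ℂ φ (spinOp (Matrix.diagonal d) ψ) =
      ∑ α, d α * inner ℂ (component α φ) (component α ψ) := by
  rw [spinOp_diagonal, inner_sum]
  refine Finset.sum_congr rfl fun α _ => ?_
  rw [inner_smul_right, inner_component_component]

theorem inner_eq_sum_component (φ ψ : Hilb M N) :
    inner ℂ φ ψ = ∑ α, inner ℂ (component α φ) (component α ψ) := by
  conv_lhs => rw [← sum_component ψ, inner_sum]
  simp only [inner_component_component]

theorem norm_sq_eq_sum_component (ψ : Hilb M N) : ‖ψ‖ ^ 2 = ∑ α, ‖component α ψ‖ ^ 2 := by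
  have := inner_eq_sum_component ψ ψ
  simp only [inner_self_eq_norm_sq_to_K] at this
  exact_mod_cast this

theorem component_translate (α : SpinIdx N) (a : Pos M) (ψ : Hilb M N) :
    component α (translate a ψ) = translate a (component α ψ) :=
  spinOp_translate _ a ψ

end Components

/-! ### Constraints and energy in terms of weights and moments -/

/-- The vector `Λ s` for the spin configuration `s ∈ {1,-1}^N` labelled by `α`. -/
def fieldAt (Λ : Matrix (Fin M) (Fin N) ℝ) (α : SpinIdx N) (m : Fin M) : ℝ :=
  ∑ n, Λ m n * spinSign (α n)

theorem sigmaZ_eq (n : Fin N) : (sigmaZ n : Hilb M N →L[ℂ] Hilb M N) =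
    spinOp (Matrix.diagonal fun α : SpinIdx N => (spinSign (α n) : ℂ)) := by
  rw [sigmaZ, liftMatrix_pauliZ]

theorem lamSigmaZ_eq (Λ : Matrix (Fin M) (Fin N) ℝ) (m : Fin M) :
    (lamSigmaZ Λ m : Hilb M N →L[ℂ] Hilb M N) =
      spinOp (Matrix.diagonal fun α : SpinIdx N => (fieldAt Λ α m : ℂ)) := by
  simp only [lamSigmaZ, sigmaZ_eq, ← spinOp_smul, ← spinOp_sum]
  congr 1
  ext α β
  simp only [Matrix.sum_apply, Matrix.smul_apply, Matrix.diagonal_apply, fieldAt]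
  split_ifs <;> simp

theorem tSigmaX_eq (t : Fin N → ℝ) : (tSigmaX t : Hilb M N →L[ℂ] Hilb M N) =
    spinOp (∑ n, (t n : ℂ) • liftMatrix pauliX n) := by
  simp only [tSigmaX, sigmaX, ← spinOp_smul, ← spinOp_sum]

theorem conjTranspose_liftMatrix_pauliX (n : Fin N) :
    (liftMatrix pauliX n).conjTranspose = liftMatrix pauliX n := by
  ext α β
  rw [Matrix.conjTranspose_apply, liftMatrix_pauliX, liftMatrix_pauliX]
  have : α = flipSpin n β ↔ β = flipSpin n α := by
    constructor <;> (rintro rfl; rw [flipSpin_flipSpin])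
  simp only [this]
  split_ifs <;> simp

theorem inner_tSigmaX (t : Fin N → ℝ) (φ ψ : Hilb M N) :
    inner ℂ φ (tSigmaX t ψ) = inner ℂ (tSigmaX t φ) ψ := by
  rw [tSigmaX_eq, inner_spinOp]
  congr 3
  rw [Matrix.conjTranspose_sum]
  refine Finset.sum_congr rfl fun n _ => ?_
  rw [Matrix.conjTranspose_smul, conjTranspose_liftMatrix_pauliX]
  simp

/-- The weight `‖ψ_α‖²` of the spin component `α`. -/
def weight (ψ : Hilb M N) (α : SpinIdx N) : ℝ := ‖component α ψ‖ ^ 2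

/-- The first moment `⟨ψ_α, x_m ψ_α⟩` of the spin component `α`. -/
def moment (ψ : Hilb M N) (α : SpinIdx N) (m : Fin M) : ℝ :=
  (inner ℂ (component α ψ) (component α (position m ψ)) : ℂ).re

theorem magnetization_apply (ψ : Hilb M N) (n : Fin N) :
    magnetization ψ n = ∑ α, spinSign (α n) * weight ψ α := by
  rw [magnetization, sigmaZ_eq, inner_spinOp_diagonal, Complex.re_sum]
  refine Finset.sum_congr rfl fun α _ => ?_
  rw [Complex.re_ofReal_mul, weight, inner_self_eq_norm_sq_to_K]
  norm_cast

theorem displacement_apply (ψ : Hilb M N) (m : Fin M) :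
    displacement ψ m = ∑ α, moment ψ α m := by
  rw [displacement, inner_eq_sum_component, Complex.re_sum]
  rfl

theorem sum_weight (ψ : Hilb M N) : ∑ α, weight ψ α = ‖ψ‖ ^ 2 :=
  (norm_sq_eq_sum_component ψ).symm

theorem sum_fieldAt_mul_weight (Λ : Matrix (Fin M) (Fin N) ℝ) (ψ : Hilb M N) (m : Fin M) :
    ∑ α, fieldAt Λ α m * weight ψ α = (Λ.mulVec (magnetization ψ)) m := by
  simp only [Matrix.mulVec, dotProduct, magnetization_apply, fieldAt, Finset.sum_mul,
    Finset.mul_sum]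
  rw [Finset.sum_comm]
  simp only [mul_assoc]

/-- Spin projections commute with multiplication by the real coordinate, so this product is real and
taking the real part in `moment` loses nothing. -/
theorem inner_component_position {ψ : Hilb M N} (hψ : ψ ∈ formDomain M N) (α : SpinIdx N)
    (m : Fin M) : inner ℂ (component α ψ) (component α (position m ψ)) = (moment ψ α m : ℂ) := by
  have h := ((isPosition_position hψ m).spinOp
    (Matrix.diagonal (Pi.single α 1) : Matrix (SpinIdx N) (SpinIdx N) ℂ)).inner_im
  apply Complex.ext
  · simp [moment]
  · simpa [component] using h

theorem inner_coupling (Λ : Matrix (Fin M) (Fin N) ℝ) {ψ : Hilb M N} (hψ : ψ ∈ formDomain M N) :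
    inner ℂ ψ (coupling Λ ψ) = ((∑ m, ∑ α, fieldAt Λ α m * moment ψ α m : ℝ) : ℂ) := by
  rw [coupling, inner_sum]
  push_cast
  refine Finset.sum_congr rfl fun m _ => ?_
  rw [lamSigmaZ_eq, inner_spinOp_diagonal]
  refine Finset.sum_congr rfl fun α _ => ?_
  rw [inner_component_position hψ]

theorem posNormSq_eq (ψ : Hilb M N) :
    posNormSq ψ = ∑ m, ∑ α, ‖component α (position m ψ)‖ ^ 2 := by
  simp only [posNormSq, norm_sq_eq_sum_component (position _ ψ)]

theorem lamSigmaZNormSq_eq (Λ : Matrix (Fin M) (Fin N) ℝ) (ψ : Hilb M N) :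
    lamSigmaZNormSq Λ ψ = ∑ m, ∑ α, fieldAt Λ α m ^ 2 * weight ψ α := by
  unfold lamSigmaZNormSq
  refine Finset.sum_congr rfl fun m _ => ?_
  rw [norm_sq_eq_sum_component]
  refine Finset.sum_congr rfl fun α _ => ?_
  have : component α (lamSigmaZ Λ m ψ) = (fieldAt Λ α m : ℂ) • component α ψ := by
    rw [lamSigmaZ_eq, spinOp_diagonal, component_sum_smul]
  rw [this, norm_smul, mul_pow, weight]
  simp

/-! ### Spin-dependent translations -/

section SpinTranslate

/-- Translation of the spin component `α` by `v α`. -/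
def spinTranslate (v : SpinIdx N → Pos M) : Hilb M N →L[ℂ] Hilb M N :=
  ∑ α, (translate (v α)).toContinuousLinearMap ∘L component α

theorem spinTranslate_apply (v : SpinIdx N → Pos M) (ψ : Hilb M N) :
    spinTranslate v ψ = ∑ α, translate (v α) (component α ψ) := by
  simp [spinTranslate]

theorem component_spinTranslate (v : SpinIdx N → Pos M) (α : SpinIdx N) (ψ : Hilb M N) :
    component α (spinTranslate v ψ) = translate (v α) (component α ψ) := by
  rw [spinTranslate_apply, map_sum]
  simp only [component_translate, component_component]
  rw [Finset.sum_eq_single α]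
  · simp
  · intro β _ hβ
    rw [if_neg hβ.symm, map_zero]
  · simp

theorem weight_spinTranslate (v : SpinIdx N → Pos M) (ψ : Hilb M N) :
    weight (spinTranslate v ψ) = weight ψ := by
  ext α
  rw [weight, component_spinTranslate, LinearIsometry.norm_map, weight]

theorem magnetization_spinTranslate (v : SpinIdx N → Pos M) (ψ : Hilb M N) :
    magnetization (spinTranslate v ψ) = magnetization ψ := by
  ext n
  simp only [magnetization_apply, weight_spinTranslate]

theorem norm_spinTranslate (v : SpinIdx N → Pos M) (ψ : Hilb M N) :
    ‖spinTranslate v ψ‖ = ‖ψ‖ := by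
  rw [← sq_eq_sq₀ (norm_nonneg _) (norm_nonneg _), ← sum_weight, ← sum_weight,
    weight_spinTranslate]

variable (v : SpinIdx N → Pos M) {ψ : Hilb M N} (hψ : ψ ∈ formDomain M N)
include hψ

theorem isWeakPartial_spinTranslate (m : Fin M) :
    IsWeakPartial m (spinTranslate v ψ) (spinTranslate v (partialD m ψ)) := by
  rw [spinTranslate_apply, spinTranslate_apply]
  refine IsWeakDeriv.sum _ fun α _ => ?_
  have h : IsWeakDeriv _ ψ (partialD m ψ) := isWeakPartial_partialD hψ m
  exact (h.spinOp _).translate _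

theorem isPosition_spinTranslate (m : Fin M) :
    IsPosition m (spinTranslate v ψ) (∑ α, translate (v α)
      (component α (position m ψ) + (v α m : ℂ) • component α ψ)) := by
  rw [spinTranslate_apply]
  refine IsPosition.sum _ fun α _ => ?_
  rw [map_add, map_smul]
  exact ((isPosition_position hψ m).spinOp _).translate _

theorem spinTranslate_mem_formDomain : spinTranslate v ψ ∈ formDomain M N :=
  mem_formDomain_of fun m => ⟨⟨_, isWeakPartial_spinTranslate v hψ m⟩,
    ⟨_, isPosition_spinTranslate v hψ m⟩⟩

theorem gradNormSq_spinTranslate : gradNormSq (spinTranslate v ψ) = gradNormSq ψ := by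
  unfold gradNormSq
  refine Finset.sum_congr rfl fun m _ => ?_
  rw [partialD_eq (isWeakPartial_spinTranslate v hψ m), norm_spinTranslate]

theorem component_position_spinTranslate (α : SpinIdx N) (m : Fin M) :
    component α (position m (spinTranslate v ψ)) =
      translate (v α) (component α (position m ψ) + (v α m : ℂ) • component α ψ) := by
  -- The sum is itself a spin-dependent translate, so its components can be read off.
  have h : (∑ α, translate (v α) (component α (position m ψ) + (v α m : ℂ) • component α ψ)) =
      spinTranslate v (position m ψ + ∑ β, (v β m : ℂ) • component β ψ) := by
    rw [spinTranslate_apply]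
    refine Finset.sum_congr rfl fun α _ => ?_
    rw [map_add (component α), component_sum_smul fun β => (v β m : ℂ)]
  rw [position_eq (isPosition_spinTranslate v hψ m), h, component_spinTranslate,
    map_add (component α), component_sum_smul fun β => (v β m : ℂ)]

theorem moment_spinTranslate (α : SpinIdx N) (m : Fin M) :
    moment (spinTranslate v ψ) α m = moment ψ α m + v α m * weight ψ α := by
  rw [moment, component_position_spinTranslate v hψ, component_spinTranslate,
    LinearIsometry.inner_map_map, inner_add_right, inner_smul_right, Complex.add_re, moment,
    Complex.re_ofReal_mul, weight, inner_self_eq_norm_sq_to_K]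
  norm_cast

theorem displacement_spinTranslate (m : Fin M) :
    displacement (spinTranslate v ψ) m = displacement ψ m + ∑ α, v α m * weight ψ α := by
  simp only [displacement_apply, moment_spinTranslate v hψ, Finset.sum_add_distrib]

theorem posNormSq_spinTranslate : posNormSq (spinTranslate v ψ) =
    posNormSq ψ + ∑ m, ∑ α, (2 * v α m * moment ψ α m + v α m ^ 2 * weight ψ α) := by
  rw [posNormSq_eq, posNormSq_eq, ← Finset.sum_add_distrib]
  refine Finset.sum_congr rfl fun m _ => ?_
  rw [← Finset.sum_add_distrib]
  refine Finset.sum_congr rfl fun α _ => ?_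
  rw [component_position_spinTranslate v hψ, LinearIsometry.norm_map, @norm_add_sq ℂ,
    inner_smul_right, ← inner_conj_symm, inner_component_position hψ, norm_smul, weight]
  simp only [Complex.conj_ofReal, RCLike.re_to_complex, ← Complex.ofReal_mul,
    Complex.ofReal_re, Complex.norm_real, mul_pow, Real.norm_eq_abs, sq_abs]
  ring

/-- All terms but t·σ_x are diagonal in the spin index, so they see only shifted moments. The t·σ_x
term mixes components with different shifts, and its change is left unevaluated. -/
theorem energy_spinTranslate (Λ : Matrix (Fin M) (Fin N) ℝ) (t : Fin N → ℝ) :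
    energy Λ t (spinTranslate v ψ) = energy Λ t ψ +
      ∑ m, ∑ α, (2 * v α m * moment ψ α m + v α m ^ 2 * weight ψ α +
        fieldAt Λ α m * v α m * weight ψ α) +
      ((inner ℂ ψ (tSigmaX t ψ)).re -
        (inner ℂ (spinTranslate v ψ) (tSigmaX t (spinTranslate v ψ))).re) := by
  have h : (inner ℂ (spinTranslate v ψ) (coupling Λ (spinTranslate v ψ)) : ℂ).re =
      (inner ℂ ψ (coupling Λ ψ) : ℂ).re + ∑ m, ∑ α, fieldAt Λ α m * v α m * weight ψ α := by
    rw [inner_coupling Λ hψ, inner_coupling Λ (spinTranslate_mem_formDomain v hψ),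
      Complex.ofReal_re, Complex.ofReal_re, ← Finset.sum_add_distrib]
    refine Finset.sum_congr rfl fun m _ => ?_
    rw [← Finset.sum_add_distrib]
    refine Finset.sum_congr rfl fun α _ => ?_
    rw [moment_spinTranslate v hψ]
    ring
  unfold energy
  rw [h, gradNormSq_spinTranslate v hψ, posNormSq_spinTranslate v hψ]
  have h2 : ∑ m, ∑ α, (2 * v α m * moment ψ α m + v α m ^ 2 * weight ψ α +
        fieldAt Λ α m * v α m * weight ψ α) =
      ∑ m, ∑ α, (2 * v α m * moment ψ α m + v α m ^ 2 * weight ψ α) +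
        ∑ m, ∑ α, fieldAt Λ α m * v α m * weight ψ α := by
    simp only [Finset.sum_add_distrib]
  rw [h2]
  ring

end SpinTranslate

/-! ### The displacement rule -/

section Displacement

variable {Λ : Matrix (Fin M) (Fin N) ℝ} {t : Fin N → ℝ} {σ : Fin N → ℝ} {ξ : Fin M → ℝ}

theorem spinTranslate_const (a : Pos M) (ψ : Hilb M N) :
    spinTranslate (fun _ => a) ψ = translate a ψ := by
  rw [spinTranslate_apply, ← map_sum, sum_component]

theorem translate_mem_constraintSet {ψ : Hilb M N} (h : ψ ∈ constraintSet σ ξ) (a : Pos M) :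
    translate a ψ ∈ constraintSet σ (ξ + a.ofLp) := by
  obtain ⟨h1, h2, h3, h4⟩ := h
  rw [← spinTranslate_const]
  refine ⟨spinTranslate_mem_formDomain _ h1, by rw [norm_spinTranslate, h2],
    by rw [magnetization_spinTranslate, h3], ?_⟩
  ext m
  rw [displacement_spinTranslate _ h1, h4, ← Finset.mul_sum, sum_weight, h2]
  simp

theorem energy_translate {ψ : Hilb M N} (h : ψ ∈ constraintSet σ ξ) (a : Pos M) :
    energy Λ t (translate a ψ) = energy Λ t ψ +
      (2 * (a ⬝ᵥ ξ) + a ⬝ᵥ Λ.mulVec σ + a ⬝ᵥ a) := by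
  obtain ⟨h1, h2, h3, h4⟩ := h
  have hT : (inner ℂ (translate a ψ) (tSigmaX t (translate a ψ)) : ℂ) =
      inner ℂ ψ (tSigmaX t ψ) := by
    rw [tSigmaX_eq, spinOp_translate, LinearIsometry.inner_map_map]
  rw [← spinTranslate_const, energy_spinTranslate _ h1, spinTranslate_const, hT, sub_self,
    add_zero]
  congr 1
  simp only [dotProduct, Finset.mul_sum, ← Finset.sum_add_distrib]
  refine Finset.sum_congr rfl fun m _ => ?_
  rw [Finset.sum_add_distrib, Finset.sum_add_distrib, ← Finset.mul_sum, ← Finset.mul_sum,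
    ← displacement_apply, h4, sum_weight, h2, ← h3, ← sum_fieldAt_mul_weight, Finset.mul_sum]
  have : ∀ α, fieldAt Λ α m * a m * weight ψ α = a m * (fieldAt Λ α m * weight ψ α) :=
    fun α => by ring
  simp only [this]
  ring

/-- Translation is a bijection between the two constraint sets and changes all energies by the same
constant. -/
theorem IsOptimizer.translate {ψ : Hilb M N} (h : IsOptimizer Λ t σ ξ ψ) (a : Pos M) :
    IsOptimizer Λ t σ (ξ + a.ofLp) (translate a ψ) := by
  refine ⟨translate_mem_constraintSet h.1 a, fun φ hφ => ?_⟩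
  have h1 := translate_mem_constraintSet hφ (-a)
  have h0 : ξ + a.ofLp + (-a : Pos M).ofLp = ξ := by
    ext m
    simp
  rw [h0] at h1
  have h2 := h.2 _ h1
  have h3 := energy_translate (Λ := Λ) (t := t) h1 a
  have h4 : Dicke.translate a (Dicke.translate (-a) φ) = φ := by
    simpa using translate_neg_translate (-a) φ
  rw [h4] at h3
  rw [energy_translate h.1, h3]
  linarith

theorem FLL_add {ψ : Hilb M N} (h : IsOptimizer Λ t σ ξ ψ) (ζ : Fin M → ℝ) :
    FLL Λ t σ (ξ + ζ) = FLL Λ t σ ξ + 2 * (ζ ⬝ᵥ ξ) + ζ ⬝ᵥ Λ.mulVec σ + ζ ⬝ᵥ ζ := by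
  have h1 := h.translate (WithLp.toLp 2 ζ)
  have h2 := energy_translate (Λ := Λ) (t := t) h.1 (WithLp.toLp 2 ζ)
  rw [h1.FLL_eq, h.FLL_eq, h2]
  ring

end Displacement

/-! ### Dilations and the virial relation -/

section Dilation

theorem memLp_comp_smul {r : ℝ} (hr : r ≠ 0) (ψ : Hilb M N) :
    MemLp (fun x : Pos M => (√|r ^ M| : ℂ) • ψ (r • x)) 2 volume := by
  have h1 : MemLp ψ 2 (Measure.map (fun x : Pos M => r • x) volume) := by
    rw [Measure.map_addHaar_smul volume hr]
    exact (Lp.memLp ψ).smul_measure ENNReal.ofReal_ne_top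
  have h2 : MemLp (fun x : Pos M => ψ (r • x)) 2 volume := h1.comp_of_map (by fun_prop)
  exact h2.const_smul (√|r ^ M| : ℂ)

theorem ae_comp_smul {r : ℝ} (hr : r ≠ 0) {p : Pos M → Prop} (h : ∀ᵐ x, p x) :
    ∀ᵐ x : Pos M, p (r • x) :=
  (Measure.quasiMeasurePreserving_smul volume hr).ae h

/-- The unitary dilation `ψ ↦ r^{M/2} ψ(r ·)`. -/
def dilate (r : ℝ) (hr : r ≠ 0) : Hilb M N →ₗᵢ[ℂ] Hilb M N :=
  LinearMap.isometryOfInner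
    { toFun := fun ψ => (memLp_comp_smul hr ψ).toLp _
      map_add' := fun ψ φ => by
        apply Lp.ext
        filter_upwards [MemLp.coeFn_toLp (memLp_comp_smul hr (ψ + φ)),
          MemLp.coeFn_toLp (memLp_comp_smul hr ψ), MemLp.coeFn_toLp (memLp_comp_smul hr φ),
          Lp.coeFn_add ((memLp_comp_smul hr ψ).toLp _) ((memLp_comp_smul hr φ).toLp _),
          ae_comp_smul hr (Lp.coeFn_add ψ φ)] with x h1 h2 h3 h4 h5
        rw [h1, h4, Pi.add_apply, h2, h3, h5, Pi.add_apply, smul_add]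
      map_smul' := fun c ψ => by
        apply Lp.ext
        filter_upwards [MemLp.coeFn_toLp (memLp_comp_smul hr (c • ψ)),
          MemLp.coeFn_toLp (memLp_comp_smul hr ψ),
          Lp.coeFn_smul c ((memLp_comp_smul hr ψ).toLp _),
          ae_comp_smul hr (Lp.coeFn_smul c ψ)] with x h1 h2 h4 h5
        rw [h1, RingHom.id_apply, h4, Pi.smul_apply, h2, h5, Pi.smul_apply, smul_comm] }
    fun ψ φ => by
      change inner ℂ ((memLp_comp_smul hr ψ).toLp _) ((memLp_comp_smul hr φ).toLp _) = _
      have h : ∀ᵐ x : Pos M, inner ℂ ((memLp_comp_smul hr ψ).toLp _ x)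
          ((memLp_comp_smul hr φ).toLp _ x) =
          |r ^ M| • (fun y => (inner ℂ (ψ y) (φ y) : ℂ)) (r • x) := by
        filter_upwards [MemLp.coeFn_toLp (memLp_comp_smul hr ψ),
          MemLp.coeFn_toLp (memLp_comp_smul hr φ)] with x h1 h2
        rw [h1, h2, inner_smul_left, inner_smul_right, Complex.conj_ofReal, ← mul_assoc,
          ← Complex.ofReal_mul, Real.mul_self_sqrt (abs_nonneg _), Complex.real_smul]
      rw [L2.inner_def, L2.inner_def, integral_congr_ae h, integral_smul,
        Measure.integral_comp_smul volume (fun y => (inner ℂ (ψ y) (φ y) : ℂ)), finrank_euclideanSpace_fin,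
        smul_smul, abs_inv,
        mul_inv_cancel₀ (by positivity), one_smul]

theorem coeFn_dilate {r : ℝ} (hr : r ≠ 0) (ψ : Hilb M N) :
    dilate r hr ψ =ᵐ[volume] fun x => (√|r ^ M| : ℂ) • ψ (r • x) :=
  MemLp.coeFn_toLp (memLp_comp_smul hr ψ)

variable {r : ℝ} (hr : r ≠ 0)

theorem dilate_translate (a : Pos M) (ψ : Hilb M N) :
    dilate r hr (translate (r • a) ψ) = translate a (dilate r hr ψ) := by
  apply Lp.ext
  filter_upwards [coeFn_dilate hr (translate (r • a) ψ),
    ae_comp_smul hr (coeFn_translate (r • a) ψ),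
    coeFn_translate a (dilate r hr ψ),
    (measurePreserving_sub_right volume a).quasiMeasurePreserving.ae (coeFn_dilate hr ψ)]
    with x h1 h2 h3 h4
  rw [h1, h2, h3, h4, smul_sub]

theorem dilate_spinOp (A : Matrix (SpinIdx N) (SpinIdx N) ℂ) (ψ : Hilb M N) :
    dilate r hr (spinOp A ψ) = spinOp A (dilate r hr ψ) := by
  apply Lp.ext
  filter_upwards [coeFn_dilate hr (spinOp A ψ), ae_comp_smul hr (coeFn_spinOp A ψ),
    coeFn_dilate hr ψ, coeFn_spinOp A (dilate r hr ψ)] with x h1 h2 h3 h4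
  rw [h1, h2, h4, h3, map_smul]

theorem IsPosition.dilate {m : Fin M} {ψ φ : Hilb M N} (h : IsPosition m ψ φ) :
    IsPosition m (dilate r hr ψ) ((r⁻¹ : ℂ) • dilate r hr φ) := by
  unfold IsPosition at *
  filter_upwards [coeFn_dilate hr ψ, coeFn_dilate hr φ, ae_comp_smul hr h,
    Lp.coeFn_smul (r⁻¹ : ℂ) (Dicke.dilate r hr φ)] with x h1 h2 h3 h4
  rw [h4, Pi.smul_apply, h2, h1, h3, smul_smul, smul_smul, smul_smul]
  congr 1
  have : (r : ℂ) ≠ 0 := by exact_mod_cast hr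
  simp only [PiLp.smul_apply, smul_eq_mul, Complex.ofReal_mul]
  field_simp

theorem IsWeakDeriv.dilate {v : Pos M} {ψ φ : Hilb M N} (h : IsWeakDeriv v ψ φ) :
    IsWeakDeriv v (dilate r hr ψ) ((r : ℂ) • dilate r hr φ) := by
  -- The dilation turns translation by r v into translation by v, so the derivative must first be
  -- taken along r v.
  have h0 : IsWeakDeriv (r • v) ψ ((r : ℂ) • φ) := by
    rw [isWeakDeriv_iff] at h ⊢
    intro η
    have h1 : ∂_{r • v} η = (r : ℂ) • ∂_{v} η := by
      ext x
      simp [SchwartzMap.lineDerivOp_apply_eq_fderiv]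
    have h2 : schwartzPairing ((r : ℂ) • ∂_{v} η) ψ = (r : ℂ) • schwartzPairing (∂_{v} η) ψ := by
      rw [schwartzPairing_apply, schwartzPairing_apply, ← integral_smul]
      simp [smul_smul]
    rw [h1, h2, h, map_smul, smul_neg]
  have h1 := h0.map (v' := v) ((Dicke.dilate r hr).toContinuousLinearMap.restrictScalars ℝ)
    fun s χ => by
      have := dilate_translate hr (s • v) χ
      rw [smul_comm] at this
      simpa using this
  have h2 : Dicke.dilate r hr ((r : ℂ) • φ) = (r : ℂ) • Dicke.dilate r hr φ := map_smul _ _ _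
  rw [← h2]
  exact h1

/-- A dilation multiplies the displacement by r⁻¹, which is harmless because the displacement is
zero. -/
theorem dilate_mem_constraintSet {σ : Fin N → ℝ} {ψ : Hilb M N} (h : ψ ∈ constraintSet σ 0) :
    dilate r hr ψ ∈ constraintSet σ 0 := by
  obtain ⟨h1, h2, h3, h4⟩ := h
  refine ⟨mem_formDomain_of fun m => ⟨⟨_, IsWeakDeriv.dilate hr (isWeakPartial_partialD h1 m)⟩,
    ⟨_, (isPosition_position h1 m).dilate hr⟩⟩, by rw [LinearIsometry.norm_map, h2], ?_, ?_⟩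
  · rw [← h3]
    ext n
    rw [magnetization, sigmaZ, ← dilate_spinOp, LinearIsometry.inner_map_map]
    rfl
  · ext m
    have h5 := congrFun h4 m
    rw [displacement] at h5 ⊢
    rw [position_eq ((isPosition_position h1 m).dilate hr), inner_smul_right,
      LinearIsometry.inner_map_map, ← Complex.ofReal_inv, Complex.re_ofReal_mul, h5]
    simp

theorem energy_dilate (Λ : Matrix (Fin M) (Fin N) ℝ) (t : Fin N → ℝ) {ψ : Hilb M N}
    (h : ψ ∈ formDomain M N) :
    energy Λ t (dilate r hr ψ) = r ^ 2 * gradNormSq ψ + (r⁻¹) ^ 2 * posNormSq ψ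
      + r⁻¹ * (inner ℂ ψ (coupling Λ ψ)).re - (inner ℂ ψ (tSigmaX t ψ)).re := by
  have h1 : gradNormSq (dilate r hr ψ) = r ^ 2 * gradNormSq ψ := by
    simp only [gradNormSq, Finset.mul_sum]
    refine Finset.sum_congr rfl fun m _ => ?_
    rw [partialD_eq (IsWeakDeriv.dilate hr (isWeakPartial_partialD h m)), norm_smul, mul_pow,
      LinearIsometry.norm_map]
    simp
  have h2 : posNormSq (dilate r hr ψ) = (r⁻¹) ^ 2 * posNormSq ψ := by
    simp only [posNormSq, Finset.mul_sum]
    refine Finset.sum_congr rfl fun m _ => ?_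
    rw [position_eq ((isPosition_position h m).dilate hr), norm_smul, mul_pow,
      LinearIsometry.norm_map, ← Complex.ofReal_inv, Complex.norm_real]
    simp
  have h3 : coupling Λ (dilate r hr ψ) = (r⁻¹ : ℂ) • dilate r hr (coupling Λ ψ) := by
    rw [coupling, coupling, map_sum, Finset.smul_sum]
    refine Finset.sum_congr rfl fun m _ => ?_
    rw [position_eq ((isPosition_position h m).dilate hr), map_smul, lamSigmaZ_eq, dilate_spinOp]
  have h4 : tSigmaX t (dilate r hr ψ) = dilate r hr (tSigmaX t ψ) := by
    rw [tSigmaX_eq, dilate_spinOp]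
  rw [energy, h1, h2, h3, h4, inner_smul_right, LinearIsometry.inner_map_map,
    LinearIsometry.inner_map_map, ← Complex.ofReal_inv, Complex.re_ofReal_mul]

/-- Among its dilates the optimizer minimizes r² G + r⁻² P + r⁻¹ C - T at r = 1, so 2G - 2P - C = 0.
-/
theorem IsOptimizer.virial {Λ : Matrix (Fin M) (Fin N) ℝ} {t : Fin N → ℝ} {σ : Fin N → ℝ}
    {ψ : Hilb M N} (h : IsOptimizer Λ t σ 0 ψ) :
    ((gradNormSq ψ - posNormSq ψ : ℝ) : ℂ) = (1 / 2 : ℂ) * inner ℂ ψ (coupling Λ ψ) := by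
  set G := gradNormSq ψ
  set P := posNormSq ψ
  set C := (inner ℂ ψ (coupling Λ ψ) : ℂ).re with hC
  set T := (inner ℂ ψ (tSigmaX t ψ) : ℂ).re with hT
  have hre : (inner ℂ ψ (coupling Λ ψ) : ℂ) = (C : ℂ) := by
    rw [hC, inner_coupling Λ h.1.1, Complex.ofReal_re]
  have hmin : IsLocalMin (fun r : ℝ => r ^ 2 * G + (r⁻¹) ^ 2 * P + r⁻¹ * C - T) 1 := by
    filter_upwards [isOpen_ne.mem_nhds (one_ne_zero : (1 : ℝ) ≠ 0)] with r hr
    have h1 := h.2 _ (dilate_mem_constraintSet hr h.1)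
    rw [energy_dilate hr Λ t h.1.1] at h1
    simpa [energy] using h1
  have hinv : HasDerivAt (fun r : ℝ => r⁻¹) (-1) 1 := by
    simpa using hasDerivAt_inv (one_ne_zero : (1 : ℝ) ≠ 0)
  have hd := ((((hasDerivAt_id (1 : ℝ)).pow 2).mul_const G).add
    ((hinv.pow 2).mul_const P)).add (hinv.mul_const C) |>.sub_const T
  have h0 := hmin.hasDerivAt_eq_zero hd
  have : G - P = 1 / 2 * C := by
    norm_num at h0
    linarith
  rw [hre, this]
  push_cast
  rfl

end Dilation

/-! ### Real-valued wavefunctions -/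

section RealValued

/-- Componentwise complex conjugation on the spin space. -/
def spinConj : Spin N →L[ℝ] Spin N :=
  haveI : FiniteDimensional ℝ (Spin N) := FiniteDimensional.complexToReal _
  LinearMap.toContinuousLinearMap
    { toFun := fun c => WithLp.toLp 2 fun α => (starRingEnd ℂ) (c α)
      map_add' := fun c d => by ext α; simp
      map_smul' := fun r c => by ext α; simp }

/-- Complex conjugation of wavefunctions. -/
def conjugate : Hilb M N →L[ℝ] Hilb M N := ContinuousLinearMap.compLpL 2 volume spinConj

theorem coeFn_conjugate (ψ : Hilb M N) : conjugate ψ =ᵐ[volume] fun x => spinConj (ψ x) :=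
  ContinuousLinearMap.coeFn_compLpL _ ψ

theorem isRealValued_iff (ψ : Hilb M N) : IsRealValued ψ ↔ conjugate ψ = ψ := by
  constructor
  · intro h
    apply Lp.ext
    filter_upwards [coeFn_conjugate ψ, h] with x h1 h2
    rw [h1]
    ext α
    exact Complex.conj_eq_iff_im.mpr (h2 α)
  · intro h
    have h1 := coeFn_conjugate ψ
    rw [h] at h1
    filter_upwards [h1] with x hx α
    have := congrArg (fun c : Spin N => c α) hx
    exact Complex.conj_eq_iff_im.mp this.symm

theorem conjugate_translate (a : Pos M) (ψ : Hilb M N) :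
    conjugate (translate a ψ) = translate a (conjugate ψ) := by
  apply Lp.ext
  filter_upwards [coeFn_conjugate (translate a ψ), coeFn_translate a ψ,
    coeFn_translate a (conjugate ψ),
    (measurePreserving_sub_right volume a).quasiMeasurePreserving.ae (coeFn_conjugate ψ)]
    with x h1 h2 h3 h4
  rw [h1, h2, h3, h4]

/-- Conjugation commutes with translations, so the conjugated derivative is again a weak derivative
of ψ; uniqueness makes it real. -/
theorem IsRealValued.partialD {ψ : Hilb M N} (h : IsRealValued ψ) (hψ : ψ ∈ formDomain M N)
    (m : Fin M) : IsRealValued (partialD m ψ) := by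
  rw [isRealValued_iff] at h ⊢
  have h1 : IsWeakDeriv _ ψ (Dicke.partialD m ψ) := isWeakPartial_partialD hψ m
  have h2 := h1.map conjugate fun s χ => conjugate_translate (s • _) χ
  rw [h] at h2
  exact h2.unique h1

theorem IsRealValued.spinOp {ψ : Hilb M N} (h : IsRealValued ψ)
    {A : Matrix (SpinIdx N) (SpinIdx N) ℂ} (hA : ∀ α β, (A α β).im = 0) :
    IsRealValued (spinOp A ψ) := by
  filter_upwards [h, coeFn_spinOp A ψ] with x h1 h2 α
  rw [h2, Matrix.ofLp_toEuclideanCLM, Matrix.mulVec, dotProduct, Complex.im_sum]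
  refine Finset.sum_eq_zero fun β _ => ?_
  rw [Complex.mul_im, h1 β, hA α β]
  simp

theorem IsRealValued.sum {ι : Type*} (s : Finset ι) {ψ : ι → Hilb M N}
    (h : ∀ i ∈ s, IsRealValued (ψ i)) : IsRealValued (∑ i ∈ s, ψ i) := by
  simp only [isRealValued_iff] at h ⊢
  rw [map_sum]
  exact Finset.sum_congr rfl h

theorem IsRealValued.inner_im {φ ψ : Hilb M N} (hφ : IsRealValued φ) (hψ : IsRealValued ψ) :
    (inner ℂ φ ψ : ℂ).im = 0 := by
  have h : (inner ℂ φ ψ : ℂ) = inner ℂ ψ φ := by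
    rw [L2.inner_def, L2.inner_def]
    apply integral_congr_ae
    filter_upwards [hφ, hψ] with x h1 h2
    simp only [PiLp.inner_apply]
    refine Finset.sum_congr rfl fun α _ => ?_
    have h3 := Complex.conj_eq_iff_im.mpr (h1 α)
    have h4 := Complex.conj_eq_iff_im.mpr (h2 α)
    simp only [RCLike.inner_apply, h3, h4]
    ring
  exact Complex.conj_eq_iff_im.mp ((inner_conj_symm ψ φ).trans h.symm)

end RealValued

/-! ### The identity for real-valued optimizers -/

section SpinDependentTranslation

variable (Λ : Matrix (Fin M) (Fin N) ℝ) (σ : Fin N → ℝ)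

/-- The vector `Λ (s - σ)` for the spin configuration `s` labelled by `α`. -/
def fieldDiff (α : SpinIdx N) : Pos M := WithLp.toLp 2 fun m => fieldAt Λ α m - Λ.mulVec σ m

theorem fieldDiff_apply (α : SpinIdx N) (m : Fin M) :
    fieldDiff Λ σ α m = fieldAt Λ α m - Λ.mulVec σ m := rfl

theorem divLamSigma_eq (ψ : Hilb M N) :
    divLamSigma Λ σ ψ =
      ∑ m, spinOp (Matrix.diagonal fun α => (fieldDiff Λ σ α m : ℂ)) (partialD m ψ) := by
  unfold divLamSigma
  refine Finset.sum_congr rfl fun m _ => ?_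
  have h : (Matrix.diagonal fun α => (fieldDiff Λ σ α m : ℂ)) =
      ∑ n, (Λ m n : ℂ) • ((Matrix.diagonal fun α : SpinIdx N => (spinSign (α n) : ℂ)) +
        (-(σ n : ℂ)) • (1 : Matrix (SpinIdx N) (SpinIdx N) ℂ)) := by
    ext α β
    rw [Matrix.sum_apply]
    by_cases hαβ : α = β
    · subst hαβ
      simp only [Matrix.diagonal_apply_eq, Matrix.smul_apply, Matrix.add_apply,
        Matrix.one_apply_eq, fieldDiff_apply, fieldAt, Matrix.mulVec, dotProduct,
        ← Finset.sum_sub_distrib, smul_eq_mul]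
      push_cast
      refine Finset.sum_congr rfl fun n _ => ?_
      ring
    · simp [hαβ]
  rw [h, spinOp_sum, sum_apply]
  refine Finset.sum_congr rfl fun n _ => ?_
  rw [spinOp_smul, spinOp_add, spinOp_smul, sigmaZ_eq, smul_apply, add_apply, smul_apply,
    spinOp_one, neg_smul, sub_eq_add_neg]

variable {Λ σ}

theorem IsRealValued.tSigmaX {ψ : Hilb M N} (h : IsRealValued ψ) (t : Fin N → ℝ) :
    IsRealValued (tSigmaX t ψ) := by
  rw [tSigmaX_eq]
  refine h.spinOp fun α β => ?_
  rw [Matrix.sum_apply, Complex.im_sum]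
  refine Finset.sum_eq_zero fun n _ => ?_
  rw [Matrix.smul_apply, liftMatrix_pauliX]
  split_ifs <;> simp

theorem IsRealValued.divLamSigma {ψ : Hilb M N} (h : IsRealValued ψ)
    (hψ : ψ ∈ formDomain M N) : IsRealValued (divLamSigma Λ σ ψ) := by
  rw [divLamSigma_eq]
  refine IsRealValued.sum _ fun m _ => (h.partialD hψ m).spinOp fun α β => ?_
  rw [Matrix.diagonal_apply]
  split_ifs <;> simp

theorem hasDerivAt_spinTranslate {ψ : Hilb M N} (hψ : ψ ∈ formDomain M N) :
    HasDerivAt (fun s : ℝ => spinTranslate (fun α => s • fieldDiff Λ σ α) ψ)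
      (-divLamSigma Λ σ ψ) 0 := by
  have h1 : ∀ α ∈ Finset.univ, HasDerivAt
      (fun s : ℝ => translate (s • fieldDiff Λ σ α) (component α ψ))
      (-∑ m, (fieldDiff Λ σ α m : ℂ) • component α (partialD m ψ)) 0 := by
    intro α _
    rw [← isWeakDeriv_iff_hasDerivAt]
    have h2 := (isWeakDeriv_of_isWeakPartial (isWeakPartial_partialD hψ)
      (fieldDiff Λ σ α)).spinOp (Matrix.diagonal (Pi.single α 1))
    rw [map_sum] at h2
    simpa only [map_smul, component] using h2
  have h3 := HasDerivAt.fun_sum h1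
  simp only [spinTranslate_apply]
  refine h3.congr_deriv ?_
  rw [divLamSigma_eq, Finset.sum_neg_distrib, Finset.sum_comm]
  simp only [spinOp_diagonal]

/-- Stationarity along the translations by s • `fieldDiff Λ σ α` gives the real part of the
identity. Real-valuedness enters only in `hDc`, where it makes the last inner product real. -/
theorem IsOptimizer.coupling_eq {t : Fin N → ℝ} {ξ : Fin M → ℝ} {ψ : Hilb M N}
    (h : IsOptimizer Λ t σ ξ ψ) (hreal : IsRealValued ψ) :
    inner ℂ ψ (coupling Λ ψ) =
      ((ξ ⬝ᵥ (Matrix.mulVec Λ σ) - 1 / 2 * lamSigmaZNormSq Λ ψ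
        + 1 / 2 * ((Matrix.mulVec Λ σ) ⬝ᵥ (Matrix.mulVec Λ σ)) : ℝ) : ℂ)
      - inner ℂ (tSigmaX t ψ) (divLamSigma Λ σ ψ) := by
  obtain ⟨⟨h1, h2, h3, h4⟩, hle⟩ := h
  set v := fieldDiff Λ σ with hv
  have hw : ∑ α, weight ψ α = 1 := by rw [sum_weight, h2, one_pow]
  have hΛ : ∀ m, ∑ α, fieldAt Λ α m * weight ψ α = Λ.mulVec σ m := by
    intro m; rw [sum_fieldAt_mul_weight, h3]
  have hξ : ∀ m, ∑ α, moment ψ α m = ξ m := by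
    intro m; rw [← displacement_apply, h4]
  set D := (inner ℂ (tSigmaX t ψ) (divLamSigma Λ σ ψ) : ℂ).re with hD
  have hDc : (inner ℂ (tSigmaX t ψ) (divLamSigma Λ σ ψ) : ℂ) = (D : ℂ) := by
    apply Complex.ext
    · simp [hD]
    · simpa using (hreal.tSigmaX t).inner_im (hreal.divLamSigma h1)
  have hzero : spinTranslate (fun α => (0 : ℝ) • v α) ψ = ψ := by
    simp only [zero_smul]
    rw [spinTranslate_const, translate_zero]
  -- The shifts have weighted mean zero: the weights sum to 1 and average `fieldAt Λ α` to Λσ. Hence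
  -- the displacement stays ξ.
  have hmem : ∀ s : ℝ, spinTranslate (fun α => s • v α) ψ ∈ constraintSet σ ξ := by
    intro s
    refine ⟨spinTranslate_mem_formDomain _ h1, by rw [norm_spinTranslate, h2],
      by rw [magnetization_spinTranslate, h3], ?_⟩
    ext m
    rw [displacement_spinTranslate _ h1, h4]
    have : ∑ α, (s • v α) m * weight ψ α =
        s * (∑ α, fieldAt Λ α m * weight ψ α - Λ.mulVec σ m * ∑ α, weight ψ α) := by
      rw [Finset.mul_sum (a := Λ.mulVec σ m), ← Finset.sum_sub_distrib, Finset.mul_sum]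
      refine Finset.sum_congr rfl fun α _ => ?_
      rw [PiLp.smul_apply, hv, fieldDiff_apply, smul_eq_mul]
      ring
    rw [this, hΛ, hw]
    simp
  have hmin : IsLocalMin (fun s : ℝ => energy Λ t (spinTranslate (fun α => s • v α) ψ)) 0 := by
    refine Eventually.of_forall fun s => ?_
    simp only [hzero]
    exact hle _ (hmem s)
  have hU := hasDerivAt_spinTranslate (Λ := Λ) (σ := σ) h1
  have hT := ((tSigmaX t).restrictScalars ℝ).hasFDerivAt.comp_hasDerivAt (0 : ℝ) hU
  have hinner := Complex.reCLM.hasFDerivAt.comp_hasDerivAt (0 : ℝ) (hU.inner ℂ hT)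
  -- The product rule gives two terms, whose real parts agree because t·σ_x is symmetric.
  have hI : HasDerivAt (fun s : ℝ => (inner ℂ (spinTranslate (fun α => s • v α) ψ)
      (tSigmaX t (spinTranslate (fun α => s • v α) ψ)) : ℂ).re) (-2 * D) 0 := by
    refine hinner.congr_deriv ?_
    simp only [Function.comp_apply, ContinuousLinearMap.coe_restrictScalars', ← hv, hzero,
      map_neg, inner_neg_left, inner_neg_right, Complex.reCLM_apply, Complex.add_re,
      Complex.neg_re, inner_tSigmaX]
    have hD' : (inner ℂ (tSigmaX t (divLamSigma Λ σ ψ)) ψ : ℂ).re = D := by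
      rw [← inner_conj_symm, Complex.conj_re, inner_tSigmaX]
    rw [hD', ← hD]
    ring
  have hq : HasDerivAt (fun s : ℝ => ∑ m, ∑ α, (2 * (s • v α) m * moment ψ α m +
      (s • v α) m ^ 2 * weight ψ α + fieldAt Λ α m * (s • v α) m * weight ψ α))
      (∑ m, ∑ α, (2 * v α m * moment ψ α m + fieldAt Λ α m * v α m * weight ψ α)) 0 := by
    refine HasDerivAt.fun_sum fun m _ => HasDerivAt.fun_sum fun α _ => ?_
    simp only [PiLp.smul_apply, smul_eq_mul]
    have hs := (hasDerivAt_id (0 : ℝ)).mul_const (v α m)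
    have := (((hs.const_mul 2).mul_const (moment ψ α m)).add
      ((hs.pow 2).mul_const (weight ψ α))).add
        ((hs.const_mul (fieldAt Λ α m)).mul_const (weight ψ α))
    refine this.congr_deriv ?_
    simp
  have hd : HasDerivAt (fun s : ℝ => energy Λ t (spinTranslate (fun α => s • v α) ψ))
      (∑ m, ∑ α, (2 * v α m * moment ψ α m + fieldAt Λ α m * v α m * weight ψ α) + 2 * D) 0 := by
    simp only [energy_spinTranslate _ h1]
    refine ((hq.const_add (energy Λ t ψ)).add (hI.const_sub _)).congr_deriv ?_
    ring
  have h0 := hmin.hasDerivAt_eq_zero hd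
  -- The weight part is the variance of Λs under the weights, namely ‖Λσ_zψ‖² - |Λσ|².
  have hC : ∑ m, ∑ α, (2 * v α m * moment ψ α m + fieldAt Λ α m * v α m * weight ψ α) =
      2 * ∑ m, ∑ α, fieldAt Λ α m * moment ψ α m - 2 * (ξ ⬝ᵥ Λ.mulVec σ) +
        lamSigmaZNormSq Λ ψ - Λ.mulVec σ ⬝ᵥ Λ.mulVec σ := by
    rw [lamSigmaZNormSq_eq, dotProduct, dotProduct, Finset.mul_sum, Finset.mul_sum,
      ← Finset.sum_sub_distrib, ← Finset.sum_add_distrib, ← Finset.sum_sub_distrib]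
    refine Finset.sum_congr rfl fun m _ => ?_
    have e : ∀ α, 2 * v α m * moment ψ α m + fieldAt Λ α m * v α m * weight ψ α =
        2 * (fieldAt Λ α m * moment ψ α m) - 2 * Λ.mulVec σ m * moment ψ α m +
          fieldAt Λ α m ^ 2 * weight ψ α - Λ.mulVec σ m * (fieldAt Λ α m * weight ψ α) := by
      intro α
      rw [hv, fieldDiff_apply]
      ring
    simp only [e, Finset.sum_sub_distrib, Finset.sum_add_distrib, ← Finset.mul_sum, hΛ, hξ]
    ring
  rw [hC] at h0
  rw [inner_coupling Λ h1, hDc, ← Complex.ofReal_sub]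
  congr 1
  linarith

end SpinDependentTranslation

/-! ### Weak derivatives from bounded difference quotients -/

section DifferenceQuotients

/-- Banach–Alaoglu for the functionals ⟨q k, ·⟩. Working along an ultrafilter avoids extracting a
weakly convergent subsequence. -/
theorem exists_weak_limit {H : Type*} [NormedAddCommGroup H] [InnerProductSpace ℂ H]
    [CompleteSpace H] {q : ℕ → H} {C : ℝ} (hq : ∀ k, ‖q k‖ ≤ C) (l : Ultrafilter ℕ) :
    ∃ φ : H, ‖φ‖ ≤ C ∧ ∀ L : H →L[ℂ] ℂ, Tendsto (fun k => L (q k)) l (𝓝 (L φ)) := by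
  let f : ℕ → WeakDual ℂ H := fun k => StrongDual.toWeakDual (InnerProductSpace.toDual ℂ H (q k))
  have hmem : ∀ k, f k ∈ WeakDual.toStrongDual ⁻¹' Metric.closedBall (0 : StrongDual ℂ H) C := by
    intro k
    simpa [f] using hq k
  obtain ⟨x, hx, hle⟩ :=
    (WeakDual.isCompact_closedBall (𝕜 := ℂ) (0 : StrongDual ℂ H) C).ultrafilter_le_nhds
    (l.map f) (le_principal_iff.mpr (mem_map.mpr (univ_mem' hmem)))
  refine ⟨(InnerProductSpace.toDual ℂ H).symm (WeakDual.toStrongDual x), ?_, fun L => ?_⟩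
  · simpa using hx
  · obtain ⟨w, rfl⟩ := (InnerProductSpace.toDual ℂ H).surjective L
    have h1 : Tendsto (fun k => f k w) l (𝓝 (x w)) :=
      ((WeakDual.eval_continuous w).tendsto x).comp hle
    -- The Riesz map is conjugate-linear: conjugation turns ⟨q k, w⟩ into the value of the
    -- functional ⟨w, ·⟩ at q k.
    have h2 := (Complex.continuous_conj.tendsto _).comp h1
    have e1 : ∀ k, (starRingEnd ℂ) (f k w) = InnerProductSpace.toDual ℂ H w (q k) := by
      intro k
      rw [InnerProductSpace.toDual_apply_apply, ← inner_conj_symm]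
      rfl
    have e2 : (starRingEnd ℂ) (x w) = InnerProductSpace.toDual ℂ H w
        ((InnerProductSpace.toDual ℂ H).symm (WeakDual.toStrongDual x)) := by
      rw [InnerProductSpace.toDual_apply_apply, ← inner_conj_symm,
        InnerProductSpace.toDual_symm_apply]
      rfl
    rw [e2] at h2
    exact h2.congr e1

/-- An `L²` function with bounded difference quotients has a weak derivative in `L²`. -/
theorem exists_isWeakDeriv {v : Pos M} {ψ : Hilb M N} {C : ℝ}
    (h : ∀ s : ℝ, 0 < s → ‖translate (s • v) ψ - ψ‖ ≤ C * s) :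
    ∃ φ, IsWeakDeriv v ψ φ ∧ ‖φ‖ ≤ C := by
  let s : ℕ → ℝ := fun k => 1 / ((k : ℝ) + 1)
  have hs : ∀ k, 0 < s k := fun k => by positivity
  -- The sign compensates the velocity -φ of the orbit. A weak limit of these quotients keeps the
  -- bound C, and pairing with η identifies it.
  let q : ℕ → Hilb M N := fun k => -((s k)⁻¹ • (translate (s k • v) ψ - ψ))
  have hq : ∀ k, ‖q k‖ ≤ C := by
    intro k
    rw [norm_neg, norm_smul, norm_inv, Real.norm_of_nonneg (hs k).le, inv_mul_le_iff₀ (hs k),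
      mul_comm]
    exact h _ (hs k)
  let l : Ultrafilter ℕ := Ultrafilter.of atTop
  obtain ⟨φ, hφ, hlim⟩ := exists_weak_limit hq l
  refine ⟨φ, ?_, hφ⟩
  rw [isWeakDeriv_iff]
  intro η
  ext α
  have h1 := hlim ((EuclideanSpace.proj α : Spin N →L[ℂ] ℂ) ∘L schwartzPairing η)
  have h2 := (hasDerivAt_schwartzPairing_translate_zero η v ψ).tendsto_slope_zero
  have hs0 : Tendsto s atTop (𝓝[≠] 0) :=
    tendsto_nhdsWithin_iff.mpr ⟨tendsto_one_div_add_atTop_nhds_zero_nat,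
      Eventually.of_forall fun k => (hs k).ne'⟩
  have h3 := ((EuclideanSpace.proj α : Spin N →L[ℂ] ℂ).continuous.tendsto _).comp
    ((h2.comp hs0).mono_left (Ultrafilter.of_le atTop))
  have h4 : ∀ k, ((EuclideanSpace.proj α : Spin N →L[ℂ] ℂ) ∘L schwartzPairing η) (q k) =
      -((EuclideanSpace.proj α : Spin N →L[ℂ] ℂ) ((s k)⁻¹ •
        (schwartzPairing η (translate ((0 + s k) • v) ψ) -
          schwartzPairing η (translate ((0 : ℝ) • v) ψ)))) := by
    intro k
    simp only [q, zero_add, zero_smul, translate_zero]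
    rw [ContinuousLinearMap.comp_apply, map_neg, map_neg, ← map_sub,
      ContinuousLinearMap.map_smul_of_tower]
  have h5 := tendsto_nhds_unique (h1.congr h4) h3.neg
  simp only [ContinuousLinearMap.comp_apply] at h5
  have h6 := neg_eq_iff_eq_neg.mpr h5
  simpa using h6.symm

end DifferenceQuotients

/-! ### Compactness in L² from control of translations and tails -/

section Compactness

theorem totallyBounded_of_approx {X : Type*} [PseudoMetricSpace X] {S : Set X}
    (h : ∀ ε > 0, ∃ S' : Set X, TotallyBounded S' ∧ ∀ x ∈ S, ∃ y ∈ S', dist x y ≤ ε) :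
    TotallyBounded S := by
  rw [Metric.totallyBounded_iff]
  intro ε hε
  obtain ⟨S', hS', hap⟩ := h (ε / 2) (by positivity)
  obtain ⟨t, ht, hcov⟩ := Metric.totallyBounded_iff.mp hS' (ε / 2) (by positivity)
  refine ⟨t, ht, fun x hx => ?_⟩
  obtain ⟨y, hy, hxy⟩ := hap x hx
  obtain ⟨z, hz, hyz⟩ := Set.mem_iUnion₂.mp (hcov hy)
  refine Set.mem_iUnion₂.mpr ⟨z, hz, ?_⟩
  rw [Metric.mem_ball] at hyz ⊢
  linarith [dist_triangle x y z]

/-- The normalized indicator function of the ball of radius `δ` around the origin. -/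
def ballKernel (M : ℕ) (δ : ℝ) : Lp ℂ 2 (volume : Measure (Pos M)) :=
  indicatorConstLp 2 (Metric.isOpen_ball (x := (0 : Pos M)) (ε := δ)).measurableSet
    measure_ball_lt_top.ne (((volume : Measure (Pos M)).real (Metric.ball 0 δ))⁻¹ : ℂ)

/-- The mean of `ψ` over the ball of radius `δ` around `x`. -/
def ballAverage (δ : ℝ) (x : Pos M) : Hilb M N →L[ℂ] Spin N :=
  (ContinuousLinearMap.lsmul ℂ ℂ (E := Spin N)).lpPairing volume 2 2
    (translate x (ballKernel M δ))

/-- The average is a pairing with a translated kernel, so its oscillation in x is governed by the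
kernel alone, uniformly for ψ in a norm ball. -/
theorem norm_ballAverage_sub_le (δ : ℝ) (x y : Pos M) (ψ : Hilb M N) :
    ‖ballAverage δ x ψ - ballAverage δ y ψ‖ ≤
      ‖(ContinuousLinearMap.lsmul ℂ ℂ (E := Spin N)).lpPairing (volume : Measure (Pos M)) 2 2‖ *
        ‖translate (x - y) (ballKernel M δ) - ballKernel M δ‖ * ‖ψ‖ := by
  unfold ballAverage
  rw [← sub_apply, ← map_sub]
  refine (ContinuousLinearMap.le_opNorm₂ _ _ _).trans_eq ?_
  congr 2
  rw [← (translate y).norm_map (translate (x - y) _ - _), map_sub, translate_translate,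
    add_sub_cancel]

theorem ballAverage_apply (δ : ℝ) (x : Pos M) (ψ : Hilb M N) :
    ballAverage δ x ψ = ⨍ y in Metric.ball (0 : Pos M) δ, ψ (x + y) := by
  rw [ballAverage, ContinuousLinearMap.lpPairing_eq_integral,
    ← integral_add_left_eq_self _ x, setAverage_eq, ← integral_smul,
    ← integral_indicator Metric.isOpen_ball.measurableSet]
  apply integral_congr_ae
  have h1 := (measurePreserving_add_left volume x).quasiMeasurePreserving.ae
    (coeFn_translate x (ballKernel M δ))
  have h2 : ballKernel M δ =ᵐ[volume] _ := indicatorConstLp_coeFn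
  filter_upwards [h1, h2] with y h1 h2
  rw [ContinuousLinearMap.lsmul_apply, h1, add_sub_cancel_left, h2]
  by_cases hy : y ∈ Metric.ball (0 : Pos M) δ
  · rw [Set.indicator_of_mem hy, Set.indicator_of_mem hy, ← Complex.ofReal_inv, Complex.coe_smul]
  · rw [Set.indicator_of_notMem hy, Set.indicator_of_notMem hy, zero_smul]

theorem integrableOn_comp_add (ψ : Hilb M N) (x : Pos M) (δ : ℝ) :
    IntegrableOn (fun y => ψ (x + y)) (Metric.ball 0 δ) := by
  have h1 : MemLp (fun y => ψ (x + y)) 2 volume :=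
    (Lp.memLp ψ).comp_measurePreserving (measurePreserving_add_left volume x)
  have : IsFiniteMeasure ((volume : Measure (Pos M)).restrict (Metric.ball 0 δ)) :=
    ⟨by simpa using measure_ball_lt_top⟩
  exact (h1.restrict _).integrable (by norm_num)

/-- The L¹ norm is at most the L² norm for the uniform probability measure on the ball. -/
theorem enorm_sub_ballAverage_sq_le {δ : ℝ} (hδ : 0 < δ) (x : Pos M) (ψ : Hilb M N) :
    ‖ψ x - ballAverage δ x ψ‖ₑ ^ 2 ≤
      ∫⁻ y, ‖ψ x - ψ (x + y)‖ₑ ^ 2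
        ∂(ProbabilityTheory.cond volume (Metric.ball (0 : Pos M) δ)) := by
  set B := Metric.ball (0 : Pos M) δ
  have hB0 : volume B ≠ 0 := (Metric.measure_ball_pos volume 0 hδ).ne'
  have hBt : volume B ≠ ⊤ := measure_ball_lt_top.ne
  set ν := ProbabilityTheory.cond (volume : Measure (Pos M)) B with hν
  have : IsProbabilityMeasure ν := ProbabilityTheory.cond_isProbabilityMeasure_of_finite hB0 hBt
  have hint : Integrable (fun y => ψ (x + y)) ν := by
    rw [hν, ProbabilityTheory.cond]
    exact (integrableOn_comp_add ψ x δ).smul_measure (by simpa using hB0)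
  have havg : ballAverage δ x ψ = ∫ y, ψ (x + y) ∂ν := by
    rw [ballAverage_apply, average, hν, ProbabilityTheory.cond]
    simp [B]
  have h1 : ψ x - ballAverage δ x ψ = ∫ y, (ψ x - ψ (x + y)) ∂ν := by
    rw [integral_sub (integrable_const _) hint, havg]
    simp
  have hm : AEStronglyMeasurable (fun y => ψ x - ψ (x + y)) ν :=
    ((integrable_const _).sub hint).aestronglyMeasurable
  have h2 : ‖ψ x - ballAverage δ x ψ‖ₑ ≤ eLpNorm (fun y => ψ x - ψ (x + y)) 2 ν := by
    rw [h1]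
    refine (enorm_integral_le_lintegral_enorm _).trans ?_
    rw [← eLpNorm_one_eq_lintegral_enorm]
    exact eLpNorm_le_eLpNorm_of_exponent_le (by norm_num) hm
  calc ‖ψ x - ballAverage δ x ψ‖ₑ ^ 2 ≤ (eLpNorm (fun y => ψ x - ψ (x + y)) 2 ν) ^ 2 := by gcongr
    _ = _ := by
      have := eLpNorm_nnreal_pow_eq_lintegral (f := fun y => ψ x - ψ (x + y)) (μ := ν)
        (p := 2) (by norm_num)
      simpa using this

/-- Integrating the pointwise estimate over x and exchanging integrals leaves, for each shift y in
the ball, a squared translation difference of at most (Cδ)². -/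
theorem eLpNorm_sub_ballAverage_le {δ C : ℝ} (hδ : 0 < δ) {ψ : Hilb M N}
    (h : ∀ a, ‖translate a ψ - ψ‖ ≤ C * ‖a‖) (hC : 0 ≤ C) :
    eLpNorm (fun x => ψ x - ballAverage δ x ψ) 2 volume ≤ ENNReal.ofReal (C * δ) := by
  set B := Metric.ball (0 : Pos M) δ with hB
  have hB0 : volume B ≠ 0 := (Metric.measure_ball_pos volume 0 hδ).ne'
  have hBt : volume B ≠ ⊤ := measure_ball_lt_top.ne
  set ν := ProbabilityTheory.cond (volume : Measure (Pos M)) B with hν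
  have : IsProbabilityMeasure ν := ProbabilityTheory.cond_isProbabilityMeasure_of_finite hB0 hBt
  have hψ : StronglyMeasurable ψ := Lp.stronglyMeasurable ψ
  have hmeas : Measurable fun p : Pos M × Pos M => ‖ψ p.1 - ψ (p.1 + p.2)‖ₑ ^ 2 := by
    have h1 : StronglyMeasurable fun p : Pos M × Pos M => ψ p.1 - ψ (p.1 + p.2) :=
      (hψ.comp_measurable measurable_fst).sub (hψ.comp_measurable (by fun_prop))
    exact h1.enorm.pow_const 2
  have hsq : ∀ (f : Pos M → Spin N), (eLpNorm f 2 volume) ^ 2 = ∫⁻ x, ‖f x‖ₑ ^ 2 := by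
    intro f
    have := eLpNorm_nnreal_pow_eq_lintegral (f := f) (μ := (volume : Measure (Pos M)))
      (p := 2) (by norm_num)
    simpa using this
  have hinner : ∀ y ∈ B, ∫⁻ x, ‖ψ x - ψ (x + y)‖ₑ ^ 2 ≤ ENNReal.ofReal (C * δ) ^ 2 := by
    intro y hy
    rw [← hsq]
    gcongr
    have h1 : (fun x => ψ x - ψ (x + y)) =ᵐ[volume] (ψ - translate (-y) ψ : Hilb M N) := by
      filter_upwards [coeFn_translate (-y) ψ, Lp.coeFn_sub ψ (translate (-y) ψ)] with x h2 h3
      rw [h3, Pi.sub_apply, h2, sub_neg_eq_add]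
    rw [eLpNorm_congr_ae h1, ← Lp.enorm_def, ← ofReal_norm, norm_sub_rev]
    refine ENNReal.ofReal_le_ofReal ((h (-y)).trans ?_)
    rw [norm_neg]
    gcongr
    simpa [hB] using (Metric.mem_ball.mp hy).le
  have hle : (eLpNorm (fun x => ψ x - ballAverage δ x ψ) 2 volume) ^ 2 ≤
      ENNReal.ofReal (C * δ) ^ 2 := by
    rw [hsq]
    calc ∫⁻ x, ‖ψ x - ballAverage δ x ψ‖ₑ ^ 2
        ≤ ∫⁻ x, ∫⁻ y, ‖ψ x - ψ (x + y)‖ₑ ^ 2 ∂ν :=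
          lintegral_mono fun x => enorm_sub_ballAverage_sq_le hδ x ψ
      _ = ∫⁻ y, ∫⁻ x, ‖ψ x - ψ (x + y)‖ₑ ^ 2 ∂volume ∂ν :=
          lintegral_lintegral_swap hmeas.aemeasurable
      _ ≤ ∫⁻ _, ENNReal.ofReal (C * δ) ^ 2 ∂ν := by
          refine lintegral_mono_ae ?_
          filter_upwards [ProbabilityTheory.ae_cond_mem Metric.isOpen_ball.measurableSet]
            with y hy using hinner y hy
      _ = _ := by simp
  exact (ENNReal.pow_le_pow_left_iff two_ne_zero).mp hle

/-- The map sending a spin vector `w` to the function equal to `w` on `s` and `0` elsewhere. -/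
def indicatorMap {s : Set (Pos M)} (hs : MeasurableSet s) (hfin : volume s ≠ ⊤) :
    Spin N →L[ℂ] Hilb M N :=
  LinearMap.toContinuousLinearMap
    { toFun := fun w => indicatorConstLp 2 hs hfin w
      map_add' := fun w w' => by
        apply Lp.ext
        filter_upwards [indicatorConstLp_coeFn (p := 2) (hs := hs) (hμs := hfin) (c := w + w'),
          indicatorConstLp_coeFn (p := 2) (hs := hs) (hμs := hfin) (c := w),
          indicatorConstLp_coeFn (p := 2) (hs := hs) (hμs := hfin) (c := w'),
          Lp.coeFn_add (indicatorConstLp 2 hs hfin w) (indicatorConstLp 2 hs hfin w')]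
          with x h1 h2 h3 h4
        rw [h1, h4, Pi.add_apply, h2, h3]
        by_cases hx : x ∈ s <;> simp [hx]
      map_smul' := fun c w => by
        apply Lp.ext
        filter_upwards [indicatorConstLp_coeFn (p := 2) (hs := hs) (hμs := hfin) (c := c • w),
          indicatorConstLp_coeFn (p := 2) (hs := hs) (hμs := hfin) (c := w),
          Lp.coeFn_smul c (indicatorConstLp 2 hs hfin w)] with x h1 h2 h4
        rw [h1, RingHom.id_apply, h4, Pi.smul_apply, h2]
        by_cases hx : x ∈ s <;> simp [hx] }

theorem coeFn_indicatorMap {s : Set (Pos M)} (hs : MeasurableSet s) (hfin : volume s ≠ ⊤)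
    (w : Spin N) : indicatorMap hs hfin w =ᵐ[volume] s.indicator fun _ => w :=
  indicatorConstLp_coeFn (hs := hs) (hμs := hfin)

theorem volume_inter_closedBall_ne_top (s : Set (Pos M)) (R : ℝ) :
    volume (s ∩ Metric.closedBall 0 R) ≠ ⊤ :=
  ((measure_mono Set.inter_subset_right).trans_lt measure_closedBall_lt_top).ne

/-- The finite rank operator which replaces `ψ` on the ball of radius `R` by its averages around
the values of a simple function. -/
def sampleOp (δ R : ℝ) (s : SimpleFunc (Pos M) (Pos M)) : Hilb M N →L[ℂ] Hilb M N :=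
  ∑ p ∈ s.range, indicatorMap
    (s.measurableSet_fiber p |>.inter Metric.isClosed_closedBall.measurableSet)
    (volume_inter_closedBall_ne_top (s ⁻¹' {p}) R) ∘L ballAverage δ p

/-- Each summand factors through the finite-dimensional spin space. -/
theorem isCompactOperator_sampleOp (δ R : ℝ) (s : SimpleFunc (Pos M) (Pos M)) :
    IsCompactOperator (sampleOp δ R s : Hilb M N →L[ℂ] Hilb M N) := by
  have h : sampleOp δ R s ∈ compactOperator (RingHom.id ℂ) (Hilb M N) (Hilb M N) := by
    refine Submodule.sum_mem _ fun p _ => ?_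
    have : IsCompactOperator (ballAverage δ p : Hilb M N →L[ℂ] Spin N) :=
      isCompactOperator_of_locallyCompactSpace_dom (ballAverage δ p)
    exact this.clm_comp (indicatorMap
      (s.measurableSet_fiber p |>.inter Metric.isClosed_closedBall.measurableSet)
      (volume_inter_closedBall_ne_top (s ⁻¹' {p}) R))
  exact h

theorem coeFn_sampleOp (δ R : ℝ) (s : SimpleFunc (Pos M) (Pos M)) (ψ : Hilb M N) :
    sampleOp δ R s ψ =ᵐ[volume]
      (Metric.closedBall 0 R).indicator fun x => ballAverage δ (s x) ψ := by
  have h1 : ∀ p, indicatorMap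
      (s.measurableSet_fiber p |>.inter Metric.isClosed_closedBall.measurableSet)
      (volume_inter_closedBall_ne_top (s ⁻¹' {p}) R) (ballAverage δ p ψ) =ᵐ[volume] _ :=
    fun p => coeFn_indicatorMap _ _ _
  have h2 : sampleOp δ R s ψ = ∑ p ∈ s.range, indicatorMap
      (s.measurableSet_fiber p |>.inter Metric.isClosed_closedBall.measurableSet)
      (volume_inter_closedBall_ne_top (s ⁻¹' {p}) R) (ballAverage δ p ψ) := by
    simp [sampleOp, sum_apply]
  rw [h2]
  refine (Lp.coeFn_finsetSum _ _).trans ?_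
  have h3 := (Filter.eventually_all_finset s.range).mpr fun p _ => h1 p
  filter_upwards [h3] with x hx
  rw [Finset.sum_apply, Finset.sum_congr rfl hx]
  by_cases hxR : x ∈ Metric.closedBall (0 : Pos M) R
  · rw [Set.indicator_of_mem hxR, Finset.sum_eq_single (s x)]
    · rw [Set.indicator_of_mem]
      exact ⟨rfl, hxR⟩
    · intro p _ hp
      rw [Set.indicator_of_notMem]
      exact fun h => hp h.1.symm
    · intro h
      exact absurd (s.mem_range_self x) h
  · rw [Set.indicator_of_notMem hxR]
    exact Finset.sum_eq_zero fun p _ => Set.indicator_of_notMem (fun h => hxR h.2) _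

theorem eLpNorm_compl_closedBall_le {C R : ℝ} (hR : 0 < R) {ψ : Hilb M N}
    (h : ∀ m, ∃ φ, IsPosition m ψ φ ∧ ‖φ‖ ≤ C) :
    eLpNorm ((Metric.closedBall (0 : Pos M) R)ᶜ.indicator ψ) 2 volume ≤
      ENNReal.ofReal (R⁻¹ * (M * C)) := by
  choose φ hφ hle using h
  have h1 : ∀ᵐ x, ‖(Metric.closedBall (0 : Pos M) R)ᶜ.indicator ψ x‖ ≤
      R⁻¹ * ‖∑ m, ‖φ m x‖‖ := by
    filter_upwards [eventually_all.mpr hφ] with x hx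
    by_cases hxR : x ∈ Metric.closedBall (0 : Pos M) R
    · rw [Set.indicator_of_notMem (by simpa using hxR), norm_zero]
      positivity
    · rw [Set.indicator_of_mem hxR, le_inv_mul_iff₀ hR,
        Real.norm_of_nonneg (Finset.sum_nonneg fun _ _ => norm_nonneg _)]
      have hR' : R < ‖x‖ := by simpa using hxR
      have hx1 : ‖x‖ ≤ ∑ m, |x m| := by
        rw [EuclideanSpace.norm_eq, Real.sqrt_le_left (by positivity)]
        simpa using Finset.sum_sq_le_sq_sum_of_nonneg (s := Finset.univ) (f := fun m => |x m|)
          fun _ _ => abs_nonneg _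
      calc R * ‖ψ x‖ ≤ (∑ m, |x m|) * ‖ψ x‖ := by
            gcongr
            exact hR'.le.trans hx1
        _ = ∑ m, ‖φ m x‖ := by
            rw [Finset.sum_mul]
            refine Finset.sum_congr rfl fun m _ => ?_
            rw [hx m, norm_smul, Complex.norm_real, Real.norm_eq_abs]
  calc eLpNorm ((Metric.closedBall (0 : Pos M) R)ᶜ.indicator ψ) 2 volume
      ≤ ENNReal.ofReal R⁻¹ * eLpNorm (fun x => ∑ m, ‖φ m x‖) 2 volume :=
        eLpNorm_le_mul_eLpNorm_of_ae_le_mul h1 2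
    _ ≤ ENNReal.ofReal R⁻¹ * ∑ m, eLpNorm (fun x => ‖φ m x‖) 2 volume := by
        gcongr
        have := eLpNorm_sum_le (μ := (volume : Measure (Pos M))) (p := 2) (s := Finset.univ)
          (f := fun m x => ‖φ m x‖) (fun m _ => (Lp.memLp (φ m)).1.norm) (by norm_num)
        have e : (fun x => ∑ m, ‖φ m x‖) = ∑ m, fun x => ‖φ m x‖ := by
          ext x
          rw [Finset.sum_apply]
        rwa [e]
    _ ≤ ENNReal.ofReal R⁻¹ * ∑ m : Fin M, ENNReal.ofReal C := by
        gcongr with m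
        rw [eLpNorm_norm, ← Lp.enorm_def, ← ofReal_norm]
        exact ENNReal.ofReal_le_ofReal (hle m)
    _ = _ := by
        rw [Finset.sum_const, Finset.card_univ, Fintype.card_fin, nsmul_eq_mul,
          ENNReal.ofReal_mul (by positivity), ENNReal.ofReal_mul (by positivity),
          ENNReal.ofReal_natCast]

theorem exists_simpleFunc_dist_lt (R : ℝ) {ρ : ℝ} (hρ : 0 < ρ) :
    ∃ s : SimpleFunc (Pos M) (Pos M), ∀ x ∈ Metric.closedBall (0 : Pos M) R,
      dist (s x) x < ρ := by
  let e := TopologicalSpace.denseSeq (Pos M)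
  obtain ⟨t, ht⟩ := (isCompact_closedBall (0 : Pos M) R).elim_finite_subcover
    (fun k => Metric.ball (e k) ρ) (fun k => Metric.isOpen_ball) fun x _ => by
      obtain ⟨k, hk⟩ := (TopologicalSpace.denseRange_denseSeq (Pos M)).exists_dist_lt x hρ
      exact Set.mem_iUnion.mpr ⟨k, hk⟩
  -- `t.sup id` is beyond every index of the finite subcover, so the nearest point is at least as
  -- close as the center of a covering ball.
  refine ⟨SimpleFunc.nearestPt e (t.sup id), fun x hx => ?_⟩
  obtain ⟨k, hk, hxk⟩ := Set.mem_iUnion₂.mp (ht hx)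
  have h1 := SimpleFunc.edist_nearestPt_le e x (Finset.le_sup (f := id) hk)
  rw [id, edist_dist, edist_dist, ENNReal.ofReal_le_ofReal_iff dist_nonneg] at h1
  refine h1.trans_lt ?_
  rw [dist_comm]
  exact hxk

/-- A Kolmogorov–Riesz argument. The tail outside a large ball, the distance to local averages and
the error of sampling these at finitely many points are each at most ε/3, uniformly on S. What
remains lies in the image of a ball under the compact operator `sampleOp`. -/
theorem totallyBounded_of_norm_le {S : Set (Hilb M N)} {C : ℝ} (hC : 0 ≤ C)
    (h1 : ∀ ψ ∈ S, ‖ψ‖ ≤ C) (h2 : ∀ ψ ∈ S, ∀ a, ‖translate a ψ - ψ‖ ≤ C * ‖a‖)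
    (h3 : ∀ ψ ∈ S, ∀ m, ∃ φ, IsPosition m ψ φ ∧ ‖φ‖ ≤ C) : TotallyBounded S := by
  refine totallyBounded_of_approx fun ε hε => ?_
  obtain ⟨R, hR, hRε⟩ : ∃ R : ℝ, 0 < R ∧ R⁻¹ * (M * C) ≤ ε / 3 := by
    refine ⟨3 * (M * C) / ε + 1, by positivity, ?_⟩
    rw [inv_mul_le_iff₀ (by positivity), add_mul, one_mul]
    have : 3 * (M * C) / ε * (ε / 3) = M * C := by field_simp
    rw [this]
    linarith
  obtain ⟨δ, hδ, hδε⟩ : ∃ δ : ℝ, 0 < δ ∧ C * δ ≤ ε / 3 := by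
    refine ⟨ε / (3 * (C + 1)), by positivity, ?_⟩
    rw [mul_div_assoc', div_le_div_iff₀ (by positivity) (by positivity)]
    nlinarith
  set K := Metric.closedBall (0 : Pos M) R with hK
  have hKt : volume K < ⊤ := measure_closedBall_lt_top
  set V := (volume.real K) ^ (2⁻¹ : ℝ) with hV
  set P := ‖(ContinuousLinearMap.lsmul ℂ ℂ (E := Spin N)).lpPairing
    (volume : Measure (Pos M)) 2 2‖ with hP
  have hV0 : 0 ≤ V := by positivity
  have hP0 : 0 ≤ P := by rw [hP]; positivity
  -- τ is the allowed L² oscillation of the kernel; V, the square root of the volume of K, converts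
  -- a sup bound into an L² bound. The + 1 covers V * P * C = 0.
  obtain ⟨τ, hτ, hτε⟩ : ∃ τ : ℝ, 0 < τ ∧ V * (P * τ * C) ≤ ε / 3 := by
    refine ⟨ε / (3 * (V * P * C + 1)), by positivity, ?_⟩
    have : V * (P * (ε / (3 * (V * P * C + 1))) * C) =
        (V * P * C) / (V * P * C + 1) * (ε / 3) := by
      field_simp
    rw [this]
    refine mul_le_of_le_one_left (by positivity) ?_
    rw [div_le_one (by positivity)]
    linarith
  obtain ⟨ρ, hρ, hρτ⟩ := Metric.continuousAt_iff.mp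
    ((continuous_translate (ballKernel M δ)).continuousAt (x := 0)) τ hτ
  obtain ⟨s, hs⟩ := exists_simpleFunc_dist_lt (M := M) R hρ
  have hKm : MeasurableSet K := Metric.isClosed_closedBall.measurableSet
  refine ⟨sampleOp δ R s '' Metric.closedBall 0 C, ?_, fun ψ hψ =>
    ⟨_, ⟨ψ, by simpa using h1 ψ hψ, rfl⟩, ?_⟩⟩
  · obtain ⟨Q, hQ, hsub⟩ :=
      (isCompactOperator_sampleOp (N := N) δ R s).image_closedBall_subset_compact
      (f := (sampleOp δ R s : Hilb M N →L[ℂ] Hilb M N).toLinearMap) C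
    exact hQ.totallyBounded.subset hsub
  have hψm : AEStronglyMeasurable ψ volume := (Lp.memLp ψ).1
  have hcont : Continuous fun x => ballAverage δ x ψ := by
    have := ((ContinuousLinearMap.lsmul ℂ ℂ (E := Spin N)).lpPairing
      (volume : Measure (Pos M)) 2 2).continuous.comp (continuous_translate (ballKernel M δ))
    exact this.clm_apply continuous_const
  have hbm : AEStronglyMeasurable (fun x => ballAverage δ x ψ) volume := hcont.aestronglyMeasurable
  have hsm : AEStronglyMeasurable (fun x => ballAverage δ (s x) ψ) volume :=
    (hcont.measurable.comp s.measurable).aestronglyMeasurable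
  have hdecomp : (ψ - sampleOp δ R s ψ : Hilb M N) =ᵐ[volume]
      (Kᶜ.indicator ψ + K.indicator fun x => ψ x - ballAverage δ x ψ) +
        K.indicator fun x => ballAverage δ x ψ - ballAverage δ (s x) ψ := by
    filter_upwards [Lp.coeFn_sub ψ (sampleOp δ R s ψ), coeFn_sampleOp δ R s ψ] with x hx1 hx2
    rw [hx1, Pi.sub_apply, hx2, Pi.add_apply, Pi.add_apply, ← hK]
    by_cases hx : x ∈ K <;> simp [Set.indicator, hx]
  have e1 : eLpNorm (Kᶜ.indicator ψ) 2 volume ≤ ENNReal.ofReal (ε / 3) :=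
    (eLpNorm_compl_closedBall_le hR (h3 ψ hψ)).trans (ENNReal.ofReal_le_ofReal hRε)
  have e2 : eLpNorm (K.indicator fun x => ψ x - ballAverage δ x ψ) 2 volume ≤
      ENNReal.ofReal (ε / 3) :=
    (eLpNorm_indicator_le _).trans ((eLpNorm_sub_ballAverage_le hδ (h2 ψ hψ) hC).trans
      (ENNReal.ofReal_le_ofReal hδε))
  have e3 : eLpNorm (K.indicator fun x => ballAverage δ x ψ - ballAverage δ (s x) ψ) 2 volume ≤
      ENNReal.ofReal (ε / 3) := by
    rw [eLpNorm_indicator_eq_eLpNorm_restrict hKm]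
    have hb : ∀ᵐ x ∂(volume.restrict K),
        ‖ballAverage δ x ψ - ballAverage δ (s x) ψ‖ ≤ P * τ * C := by
      filter_upwards [ae_restrict_mem hKm] with x hx
      refine (norm_ballAverage_sub_le δ x (s x) ψ).trans ?_
      have hd : dist (x - s x) 0 < ρ := by
        rw [dist_zero_right, ← dist_eq_norm, dist_comm]
        exact hs x hx
      have := (hρτ hd).le
      rw [translate_zero, dist_eq_norm] at this
      gcongr
      exact h1 ψ hψ
    refine (eLpNorm_le_of_ae_bound hb).trans ?_
    rw [Measure.restrict_apply_univ, ← ENNReal.ofReal_toReal hKt.ne,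
      ENNReal.ofReal_rpow_of_nonneg ENNReal.toReal_nonneg (by positivity),
      ← ENNReal.ofReal_mul (by positivity)]
    refine ENNReal.ofReal_le_ofReal ?_
    simpa [hV, Measure.real] using hτε
  have hle : ‖ψ - sampleOp δ R s ψ‖ₑ ≤ ENNReal.ofReal ε := by
    rw [Lp.enorm_def, eLpNorm_congr_ae hdecomp]
    calc _ ≤ (ENNReal.ofReal (ε / 3) + ENNReal.ofReal (ε / 3)) + ENNReal.ofReal (ε / 3) := by
          refine (eLpNorm_add_le ((hψm.indicator hKm.compl).add
            ((hψm.sub hbm).indicator hKm)) ((hbm.sub hsm).indicator hKm) (by norm_num)).trans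
            (add_le_add ?_ e3)
          exact (eLpNorm_add_le (hψm.indicator hKm.compl)
            ((hψm.sub hbm).indicator hKm) (by norm_num)).trans (add_le_add e1 e2)
      _ = ENNReal.ofReal ε := by
          rw [← ENNReal.ofReal_add (by positivity) (by positivity),
            ← ENNReal.ofReal_add (by positivity) (by positivity)]
          congr 1
          ring
  rw [dist_eq_norm]
  rw [← ofReal_norm] at hle
  exact (ENNReal.ofReal_le_ofReal_iff hε.le).mp hle

end Compactness

/-! ### Existence of optimizers by the direct method -/

section Minimization

theorem norm_translate_sub_le {ψ : Hilb M N} (h : ψ ∈ formDomain M N) (a : Pos M) :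
    ‖translate a ψ - ψ‖ ≤ (∑ m, ‖partialD m ψ‖) * ‖a‖ := by
  have h1 := (isWeakDeriv_of_isWeakPartial (isWeakPartial_partialD h) a).norm_translate_sub_le 1
  rw [one_smul, abs_one, mul_one] at h1
  refine h1.trans ((norm_sum_le _ _).trans ?_)
  rw [Finset.sum_mul]
  refine Finset.sum_le_sum fun m _ => ?_
  rw [norm_smul, Complex.norm_real, mul_comm]
  gcongr
  exact PiLp.norm_apply_le a m

/-- A lower bound for the spin-dependent part of the energy. -/
def energyOffset (Λ : Matrix (Fin M) (Fin N) ℝ) (t : Fin N → ℝ) : ℝ :=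
  (∑ m, ‖(lamSigmaZ Λ m : Hilb M N →L[ℂ] Hilb M N)‖ ^ 2 / 2) +
    ‖(tSigmaX t : Hilb M N →L[ℂ] Hilb M N)‖

/-- Young's inequality spends half of ‖xψ‖² on the coupling, and t·σ_x is bounded. This coercivity
gives both the lower bound on the energy and the a priori bounds on minimizing sequences. -/
theorem gradNormSq_add_posNormSq_le (Λ : Matrix (Fin M) (Fin N) ℝ) (t : Fin N → ℝ)
    {ψ : Hilb M N} (hψ : ‖ψ‖ = 1) :
    gradNormSq ψ + posNormSq ψ / 2 ≤ energy Λ t ψ + energyOffset Λ t := by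
  have h1 : |(inner ℂ ψ (tSigmaX t ψ) : ℂ).re| ≤ ‖(tSigmaX t : Hilb M N →L[ℂ] Hilb M N)‖ := by
    refine (Complex.abs_re_le_norm _).trans ((norm_inner_le_norm _ _).trans ?_)
    have := (tSigmaX t : Hilb M N →L[ℂ] Hilb M N).le_opNorm ψ
    rw [hψ, mul_one] at this
    rwa [hψ, one_mul]
  have h2 : |(inner ℂ ψ (coupling Λ ψ) : ℂ).re| ≤
      (∑ m, ‖(lamSigmaZ Λ m : Hilb M N →L[ℂ] Hilb M N)‖ ^ 2 / 2) + posNormSq ψ / 2 := by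
    refine (Complex.abs_re_le_norm _).trans ((norm_inner_le_norm _ _).trans ?_)
    rw [hψ, one_mul, coupling, posNormSq, Finset.sum_div, ← Finset.sum_add_distrib]
    refine (norm_sum_le _ _).trans (Finset.sum_le_sum fun m _ => ?_)
    refine ((lamSigmaZ Λ m).le_opNorm _).trans ?_
    nlinarith [sq_nonneg (‖(lamSigmaZ Λ m : Hilb M N →L[ℂ] Hilb M N)‖ - ‖position m ψ‖)]
  rw [energy, energyOffset]
  linarith [abs_le.mp h1, abs_le.mp h2]

theorem gradNormSq_nonneg (ψ : Hilb M N) : 0 ≤ gradNormSq ψ :=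
  Finset.sum_nonneg fun _ _ => sq_nonneg _

theorem posNormSq_nonneg (ψ : Hilb M N) : 0 ≤ posNormSq ψ :=
  Finset.sum_nonneg fun _ _ => sq_nonneg _

/-- Fatou's lemma along an almost everywhere convergent subsequence. -/
theorem exists_isPosition_of_tendsto {m : Fin M} {ψ φ : ℕ → Hilb M N} {ψ₀ : Hilb M N} {p : ℝ}
    (hψ : Tendsto ψ atTop (𝓝 ψ₀)) (hφ : ∀ k, IsPosition m (ψ k) (φ k))
    (hp : Tendsto (fun k => ‖φ k‖) atTop (𝓝 p)) : ∃ φ₀, IsPosition m ψ₀ φ₀ ∧ ‖φ₀‖ ≤ p := by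
  obtain ⟨ns, hns, hae⟩ := (tendstoInMeasure_of_tendsto_Lp hψ).exists_seq_tendsto_ae
  have hlim : ∀ᵐ x : Pos M, Tendsto (fun k => φ (ns k) x) atTop
      (𝓝 (((x m : ℝ) : ℂ) • ψ₀ x)) := by
    filter_upwards [hae, ae_all_iff.mpr hφ] with x h1 h2
    simp only [h2]
    exact h1.const_smul _
  have hle := Lp.eLpNorm_lim_le_liminf_eLpNorm (p := 2) (fun k => (Lp.memLp (φ (ns k))).1) _ hlim
  have hto : Tendsto (fun k => eLpNorm (φ (ns k)) 2 volume) atTop (𝓝 (ENNReal.ofReal p)) := by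
    have := (ENNReal.continuous_ofReal.tendsto p).comp (hp.comp hns.tendsto_atTop)
    refine this.congr fun k => ?_
    rw [Function.comp_apply, Function.comp_apply, ofReal_norm, Lp.enorm_def]
  rw [hto.liminf_eq] at hle
  have hmem : MemLp (fun x : Pos M => ((x m : ℝ) : ℂ) • ψ₀ x) 2 volume :=
    ⟨aestronglyMeasurable_of_tendsto_ae atTop (fun k => (Lp.memLp (φ (ns k))).1) hlim,
      hle.trans_lt ENNReal.ofReal_lt_top⟩
  refine ⟨hmem.toLp _, hmem.coeFn_toLp, ?_⟩
  have hp0 : 0 ≤ p := ge_of_tendsto' hp fun k => norm_nonneg _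
  rw [← ENNReal.ofReal_le_ofReal_iff hp0, ofReal_norm, Lp.enorm_def,
    eLpNorm_congr_ae hmem.coeFn_toLp]
  exact hle

/-- The translation bound passes to the L² limit, and bounded difference quotients give back a weak
derivative with the same bound. -/
theorem exists_isWeakDeriv_of_tendsto {v : Pos M} {ψ φ : ℕ → Hilb M N} {ψ₀ : Hilb M N} {p : ℝ}
    (hψ : Tendsto ψ atTop (𝓝 ψ₀)) (hφ : ∀ k, IsWeakDeriv v (ψ k) (φ k))
    (hp : Tendsto (fun k => ‖φ k‖) atTop (𝓝 p)) : ∃ φ₀, IsWeakDeriv v ψ₀ φ₀ ∧ ‖φ₀‖ ≤ p := by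
  refine exists_isWeakDeriv fun s hs => ?_
  have h1 : Tendsto (fun k => ‖translate (s • v) (ψ k) - ψ k‖) atTop
      (𝓝 ‖translate (s • v) ψ₀ - ψ₀‖) :=
    ((((translate (s • v)).continuous.tendsto ψ₀).comp hψ).sub hψ).norm
  refine le_of_tendsto_of_tendsto' h1 (hp.mul_const s) fun k => ?_
  have := (hφ k).norm_translate_sub_le s
  rwa [abs_of_pos hs] at this

/-- The products x_m ψ_k are only bounded in norm, so x_m is moved onto the fixed χ₀; the error is
‖χ_k - χ₀‖ times a bounded factor. -/
theorem tendsto_inner_position {m : Fin M} {ψ φ χ : ℕ → Hilb M N} {ψ₀ φ₀ χ₀ χ₁ : Hilb M N} {p : ℝ}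
    (hψ : Tendsto ψ atTop (𝓝 ψ₀)) (hχ : Tendsto χ atTop (𝓝 χ₀))
    (hφ : ∀ k, IsPosition m (ψ k) (φ k)) (hφ₀ : IsPosition m ψ₀ φ₀) (hχ₀ : IsPosition m χ₀ χ₁)
    (hp : Tendsto (fun k => ‖φ k‖) atTop (𝓝 p)) :
    Tendsto (fun k => (inner ℂ (χ k) (φ k) : ℂ)) atTop (𝓝 (inner ℂ χ₀ φ₀)) := by
  have h1 : ∀ k, (inner ℂ (χ k) (φ k) : ℂ) = inner ℂ (χ k - χ₀) (φ k) + inner ℂ χ₁ (ψ k) := by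
    intro k
    rw [hχ₀.inner_comm (hφ k), inner_sub_left, sub_add_cancel]
  have h2 : Tendsto (fun k => (inner ℂ (χ k - χ₀) (φ k) : ℂ)) atTop (𝓝 0) := by
    refine squeeze_zero_norm (fun k => norm_inner_le_norm _ _) ?_
    have h3 : Tendsto (fun k => ‖χ k - χ₀‖) atTop (𝓝 0) := by
      simpa using (hχ.sub_const χ₀).norm
    simpa using h3.mul hp
  have h4 : Tendsto (fun k => (inner ℂ χ₁ (ψ k) : ℂ)) atTop (𝓝 (inner ℂ χ₁ ψ₀)) :=
    tendsto_const_nhds.inner hψ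
  rw [← hχ₀.inner_comm hφ₀]
  simpa [h1] using h2.add h4

theorem tendsto_inner_coupling (Λ : Matrix (Fin M) (Fin N) ℝ) {ψ : ℕ → Hilb M N} {ψ₀ : Hilb M N}
    {p : Fin M → ℝ} (hψ : Tendsto ψ atTop (𝓝 ψ₀)) (hmem : ∀ k, ψ k ∈ formDomain M N)
    (hmem₀ : ψ₀ ∈ formDomain M N)
    (hp : ∀ m, Tendsto (fun k => ‖position m (ψ k)‖) atTop (𝓝 (p m))) :
    Tendsto (fun k => (inner ℂ (ψ k) (coupling Λ (ψ k)) : ℂ)) atTop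
      (𝓝 (inner ℂ ψ₀ (coupling Λ ψ₀))) := by
  simp only [coupling, inner_sum, lamSigmaZ_eq, inner_spinOp]
  refine tendsto_finsetSum _ fun m _ => ?_
  exact tendsto_inner_position hψ (((ContinuousLinearMap.continuous _).tendsto ψ₀).comp hψ)
    (fun k => isPosition_position (hmem k) m) (isPosition_position hmem₀ m)
    ((isPosition_position hmem₀ m).spinOp _) (hp m)

theorem mem_constraintSet_of_tendsto {σ : Fin N → ℝ} {ξ : Fin M → ℝ} {ψ : ℕ → Hilb M N}
    {ψ₀ : Hilb M N} {p : Fin M → ℝ} (hψ : Tendsto ψ atTop (𝓝 ψ₀))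
    (hmem : ∀ k, ψ k ∈ constraintSet σ ξ) (hmem₀ : ψ₀ ∈ formDomain M N)
    (hp : ∀ m, Tendsto (fun k => ‖position m (ψ k)‖) atTop (𝓝 (p m))) :
    ψ₀ ∈ constraintSet σ ξ := by
  refine ⟨hmem₀, ?_, ?_, ?_⟩
  · refine tendsto_nhds_unique hψ.norm ?_
    simp [fun k => (hmem k).2.1]
  · ext n
    have h1 : Tendsto (fun k => magnetization (ψ k) n) atTop (𝓝 (magnetization ψ₀ n)) :=
      (Complex.continuous_re.tendsto _).comp
        (hψ.inner (((ContinuousLinearMap.continuous (sigmaZ n)).tendsto ψ₀).comp hψ))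
    refine tendsto_nhds_unique h1 ?_
    simp [fun k => (hmem k).2.2.1]
  · ext m
    have h1 : Tendsto (fun k => displacement (ψ k) m) atTop (𝓝 (displacement ψ₀ m)) :=
      (Complex.continuous_re.tendsto _).comp
        (tendsto_inner_position hψ hψ (fun k => isPosition_position (hmem k).1 m)
          (isPosition_position hmem₀ m) (isPosition_position hmem₀ m) (hp m))
    refine tendsto_nhds_unique h1 ?_
    simp [fun k => (hmem k).2.2.2]

theorem exists_isOptimizer (Λ : Matrix (Fin M) (Fin N) ℝ) (t : Fin N → ℝ) {σ : Fin N → ℝ}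
    {ξ : Fin M → ℝ} (hne : (constraintSet σ ξ : Set (Hilb M N)).Nonempty) :
    ∃ ψ : Hilb M N, IsOptimizer Λ t σ ξ ψ := by
  have hbdd : BddBelow (energy Λ t '' (constraintSet σ ξ : Set (Hilb M N))) := by
    refine ⟨-energyOffset Λ t, ?_⟩
    rintro _ ⟨φ, hφ, rfl⟩
    linarith [gradNormSq_add_posNormSq_le Λ t hφ.2.1, gradNormSq_nonneg φ, posNormSq_nonneg φ]
  obtain ⟨u, -, hu, hmem⟩ := exists_seq_tendsto_sInf (hne.image (energy Λ t)) hbdd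
  choose ψ hψ hψu using hmem
  obtain ⟨b, hb⟩ := hu.bddAbove_range
  have hb' : ∀ k, gradNormSq (ψ k) + posNormSq (ψ k) / 2 ≤ b + energyOffset Λ t := by
    intro k
    refine (gradNormSq_add_posNormSq_le Λ t (hψ k).2.1).trans ?_
    rw [hψu]
    gcongr
    exact hb ⟨k, rfl⟩
  set c := 2 * (b + energyOffset Λ t) with hc
  have hc0 : 0 ≤ c := by
    linarith [hb' 0, gradNormSq_nonneg (ψ 0), posNormSq_nonneg (ψ 0)]
  have hD : ∀ k m, ‖partialD m (ψ k)‖ ≤ √c := by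
    intro k m
    refine Real.le_sqrt_of_sq_le ?_
    have := Finset.single_le_sum (f := fun m => ‖partialD m (ψ k)‖ ^ 2)
      (fun _ _ => sq_nonneg _) (Finset.mem_univ m)
    change _ ≤ gradNormSq (ψ k) at this
    linarith [hb' k, posNormSq_nonneg (ψ k), gradNormSq_nonneg (ψ k)]
  have hX : ∀ k m, ‖position m (ψ k)‖ ≤ √c := by
    intro k m
    refine Real.le_sqrt_of_sq_le ?_
    have := Finset.single_le_sum (f := fun m => ‖position m (ψ k)‖ ^ 2)
      (fun _ _ => sq_nonneg _) (Finset.mem_univ m)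
    change _ ≤ posNormSq (ψ k) at this
    linarith [hb' k, gradNormSq_nonneg (ψ k)]
  have htb : TotallyBounded (Set.range ψ) := by
    -- One constant dominates the norm 1, the sum of M derivative norms and each position norm.
    refine totallyBounded_of_norm_le (C := 1 + (M + 1) * √c) (by positivity) ?_ ?_ ?_
    · rintro _ ⟨k, rfl⟩
      rw [(hψ k).2.1]
      have : 0 ≤ (M + 1) * √c := by positivity
      linarith
    · rintro _ ⟨k, rfl⟩ a
      refine (norm_translate_sub_le (hψ k).1 a).trans ?_
      gcongr
      refine (Finset.sum_le_sum fun m _ => hD k m).trans ?_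
      simp only [Finset.sum_const, Finset.card_univ, Fintype.card_fin, nsmul_eq_mul]
      linarith [Real.sqrt_nonneg c]
    · rintro _ ⟨k, rfl⟩ m
      refine ⟨_, isPosition_position (hψ k).1 m, (hX k m).trans ?_⟩
      nlinarith [Real.sqrt_nonneg c, (Nat.cast_nonneg M : (0 : ℝ) ≤ M)]
  -- The derivative and position norms are bundled with the states, so that a single subsequence
  -- makes all of them converge.
  have hK : IsCompact (closure (Set.range ψ) ×ˢ
      ((Set.univ.pi fun _ : Fin M => Set.Icc (0 : ℝ) (√c)) ×ˢ
        (Set.univ.pi fun _ : Fin M => Set.Icc (0 : ℝ) (√c)))) :=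
    (htb.closure.isCompact_of_isClosed isClosed_closure).prod
      ((isCompact_univ_pi fun _ => isCompact_Icc).prod (isCompact_univ_pi fun _ => isCompact_Icc))
  obtain ⟨⟨ψ₀, d, p⟩, -, ns, hns, hlim⟩ := hK.tendsto_subseq
    (x := fun k => (ψ k, (fun m => ‖partialD m (ψ k)‖), fun m => ‖position m (ψ k)‖))
    fun k => ⟨subset_closure ⟨k, rfl⟩, fun m _ => ⟨norm_nonneg _, hD k m⟩,
      fun m _ => ⟨norm_nonneg _, hX k m⟩⟩
  rw [nhds_prod_eq, nhds_prod_eq] at hlim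
  have hψ₀ : Tendsto (fun k => ψ (ns k)) atTop (𝓝 ψ₀) := hlim.fst
  have hd : ∀ m, Tendsto (fun k => ‖partialD m (ψ (ns k))‖) atTop (𝓝 (d m)) :=
    tendsto_pi_nhds.mp hlim.snd.fst
  have hp : ∀ m, Tendsto (fun k => ‖position m (ψ (ns k))‖) atTop (𝓝 (p m)) :=
    tendsto_pi_nhds.mp hlim.snd.snd
  have hDlim : ∀ m, ∃ φ, IsWeakPartial m ψ₀ φ ∧ ‖φ‖ ≤ d m := fun m =>
    exists_isWeakDeriv_of_tendsto hψ₀ (fun k => isWeakPartial_partialD (hψ (ns k)).1 m) (hd m)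
  have hXlim : ∀ m, ∃ φ, IsPosition m ψ₀ φ ∧ ‖φ‖ ≤ p m := fun m =>
    exists_isPosition_of_tendsto hψ₀ (fun k => isPosition_position (hψ (ns k)).1 m) (hp m)
  have hmem₀ : ψ₀ ∈ formDomain M N := mem_formDomain_of fun m =>
    ⟨(hDlim m).imp fun _ h => h.1, (hXlim m).imp fun _ h => h.1⟩
  have hcon := mem_constraintSet_of_tendsto hψ₀ (fun k => hψ (ns k)) hmem₀ hp
  refine ⟨ψ₀, hcon, fun φ hφ => ?_⟩
  have hT : Tendsto (fun k => (inner ℂ (ψ (ns k)) (tSigmaX t (ψ (ns k))) : ℂ)) atTop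
      (𝓝 (inner ℂ ψ₀ (tSigmaX t ψ₀))) :=
    hψ₀.inner (((ContinuousLinearMap.continuous (tSigmaX t)).tendsto ψ₀).comp hψ₀)
  have hE : Tendsto (fun k => energy Λ t (ψ (ns k))) atTop
      (𝓝 (∑ m, d m ^ 2 + ∑ m, p m ^ 2 + (inner ℂ ψ₀ (coupling Λ ψ₀) : ℂ).re -
        (inner ℂ ψ₀ (tSigmaX t ψ₀) : ℂ).re)) :=
    (((tendsto_finsetSum _ fun m _ => (hd m).pow 2).add
      (tendsto_finsetSum _ fun m _ => (hp m).pow 2)).add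
      ((Complex.continuous_re.tendsto _).comp
        (tendsto_inner_coupling Λ hψ₀ (fun k => (hψ (ns k)).1) hmem₀ hp))).sub
      ((Complex.continuous_re.tendsto _).comp hT)
  have hE' : Tendsto (fun k => energy Λ t (ψ (ns k))) atTop
      (𝓝 (sInf (energy Λ t '' (constraintSet σ ξ : Set (Hilb M N))))) := by
    simp only [hψu]
    exact hu.comp hns.tendsto_atTop
  -- The coupling and t·σ_x terms converge; the gradient and position norms can only drop in the
  -- limit.
  have hle : energy Λ t ψ₀ ≤ sInf (energy Λ t '' (constraintSet σ ξ : Set (Hilb M N))) := by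
    rw [← tendsto_nhds_unique hE hE', energy, gradNormSq, posNormSq]
    gcongr with m _ m _
    · obtain ⟨φ, h1, h2⟩ := hDlim m
      rwa [partialD_eq h1]
    · obtain ⟨φ, h1, h2⟩ := hXlim m
      rwa [position_eq h1]
  exact hle.trans (csInf_le hbdd ⟨φ, hφ, rfl⟩)

end Minimization

/-! ### Real-valued optimizers from signed moduli -/

section ModulusWave

/-- The sign of the spin component `α` in a real minimizer of `-t · σ_x`. -/
def componentSign (t : Fin N → ℝ) (α : SpinIdx N) : ℝ :=
  ∏ n, if t n < 0 then spinSign (α n) else 1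

theorem componentSign_mul_self (t : Fin N → ℝ) (α : SpinIdx N) :
    componentSign t α * componentSign t α = 1 := by
  rw [componentSign, ← Finset.prod_mul_distrib]
  refine Finset.prod_eq_one fun n _ => ?_
  split_ifs
  · exact spinSign_mul_self _
  · norm_num

theorem abs_componentSign (t : Fin N → ℝ) (α : SpinIdx N) : |componentSign t α| = 1 := by
  have := componentSign_mul_self t α
  rw [← abs_mul_abs_self] at this
  nlinarith [abs_nonneg (componentSign t α)]

/-- Flipping spin n affects only the n-th factor of the sign, which changes exactly when t n < 0. -/
theorem mul_componentSign_mul_flipSpin (t : Fin N → ℝ) (n : Fin N) (α : SpinIdx N) :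
    t n * (componentSign t α * componentSign t (flipSpin n α)) = |t n| := by
  have h : componentSign t α * componentSign t (flipSpin n α) = if t n < 0 then -1 else 1 := by
    rw [componentSign, componentSign, ← Finset.prod_mul_distrib, Finset.prod_eq_single n]
    · split_ifs
      · have : ∀ i : Fin 2, spinSign i * spinSign (1 - i) = -1 := by
          intro i; fin_cases i <;> simp [spinSign]
        simp [flipSpin, this]
      · norm_num
    · intro k _ hk
      rw [flipSpin, Function.update_of_ne hk]
      split_ifs
      · exact spinSign_mul_self _
      · norm_num
    · simp
  rw [h]
  split_ifs with ht
  · rw [abs_of_neg ht]; ring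
  · rw [abs_of_nonneg (not_lt.mp ht)]; ring

/-- Replace all components of a spin vector by their moduli, up to signs. -/
def modulus (t : Fin N → ℝ) (c : Spin N) : Spin N :=
  WithLp.toLp 2 fun α => ((componentSign t α * ‖c α‖ : ℝ) : ℂ)

theorem modulus_apply (t : Fin N → ℝ) (c : Spin N) (α : SpinIdx N) :
    modulus t c α = ((componentSign t α * ‖c α‖ : ℝ) : ℂ) := rfl

theorem norm_modulus_apply (t : Fin N → ℝ) (c : Spin N) (α : SpinIdx N) :
    ‖modulus t c α‖ = ‖c α‖ := by
  rw [modulus_apply, Complex.norm_real, Real.norm_eq_abs, abs_mul, abs_componentSign, one_mul,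
    abs_norm]

theorem norm_modulus (t : Fin N → ℝ) (c : Spin N) : ‖modulus t c‖ = ‖c‖ := by
  simp only [EuclideanSpace.norm_eq, norm_modulus_apply]

theorem lipschitzWith_modulus (t : Fin N → ℝ) : LipschitzWith 1 (modulus t) := by
  refine LipschitzWith.of_dist_le_mul fun c d => ?_
  rw [NNReal.coe_one, one_mul, EuclideanSpace.dist_eq, EuclideanSpace.dist_eq]
  refine Real.sqrt_le_sqrt (Finset.sum_le_sum fun α _ => ?_)
  gcongr
  rw [modulus_apply, modulus_apply, dist_eq_norm, ← Complex.ofReal_sub, Complex.norm_real,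
    ← mul_sub, norm_mul, Real.norm_eq_abs, abs_componentSign, one_mul, dist_eq_norm,
    Real.norm_eq_abs]
  exact abs_norm_sub_norm_le _ _

theorem modulus_zero (t : Fin N → ℝ) : modulus t 0 = 0 := by
  ext α
  simp [modulus_apply]

/-- Replace all spin components of a wavefunction by their moduli, up to signs. -/
def modulusWave (t : Fin N → ℝ) (ψ : Hilb M N) : Hilb M N :=
  (lipschitzWith_modulus t).compLp (modulus_zero t) ψ

theorem coeFn_modulusWave (t : Fin N → ℝ) (ψ : Hilb M N) :
    modulusWave t ψ =ᵐ[volume] fun x => modulus t (ψ x) :=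
  LipschitzWith.coeFn_compLp _ _ _

theorem isRealValued_modulusWave (t : Fin N → ℝ) (ψ : Hilb M N) :
    IsRealValued (modulusWave t ψ) := by
  filter_upwards [coeFn_modulusWave t ψ] with x hx α
  rw [hx, modulus_apply, Complex.ofReal_im]

theorem modulusWave_translate (t : Fin N → ℝ) (a : Pos M) (ψ : Hilb M N) :
    modulusWave t (translate a ψ) = translate a (modulusWave t ψ) := by
  apply Lp.ext
  filter_upwards [coeFn_modulusWave t (translate a ψ), coeFn_translate a ψ,
    coeFn_translate a (modulusWave t ψ),
    (measurePreserving_sub_right volume a).quasiMeasurePreserving.ae (coeFn_modulusWave t ψ)]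
    with x h1 h2 h3 h4
  rw [h1, h2, h3, h4]

theorem norm_modulusWave_sub_le (t : Fin N → ℝ) (ψ φ : Hilb M N) :
    ‖modulusWave t ψ - modulusWave t φ‖ ≤ ‖ψ - φ‖ := by
  have := (lipschitzWith_modulus t).norm_compLp_sub_le (modulus_zero t) ψ φ
  rwa [NNReal.coe_one, one_mul] at this

/-- The signed modulus is 1-Lipschitz and commutes with translations, so difference quotients do not
grow; no chain rule for the absolute value is needed. -/
theorem exists_isWeakPartial_modulusWave (t : Fin N → ℝ) {m : Fin M} {ψ φ : Hilb M N}
    (h : IsWeakPartial m ψ φ) :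
    ∃ φ', IsWeakPartial m (modulusWave t ψ) φ' ∧ ‖φ'‖ ≤ ‖φ‖ := by
  refine exists_isWeakDeriv fun s hs => ?_
  rw [← modulusWave_translate]
  refine (norm_modulusWave_sub_le t _ _).trans ?_
  have := IsWeakDeriv.norm_translate_sub_le h s
  rwa [abs_of_pos hs] at this

theorem exists_isPosition_modulusWave (t : Fin N → ℝ) {m : Fin M} {ψ φ : Hilb M N}
    (h : IsPosition m ψ φ) :
    ∃ φ', IsPosition m (modulusWave t ψ) φ' ∧ ‖φ'‖ ≤ ‖φ‖ := by
  have hle : ∀ᵐ x : Pos M, ‖((x m : ℝ) : ℂ) • modulusWave t ψ x‖ ≤ ‖φ x‖ := by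
    unfold IsPosition at h
    filter_upwards [h, coeFn_modulusWave t ψ] with x h1 h2
    rw [h1, h2, norm_smul, norm_smul, norm_modulus]
  have hc : Continuous fun x : Pos M => ((x m : ℝ) : ℂ) := by fun_prop
  have hm : AEStronglyMeasurable (fun x : Pos M => ((x m : ℝ) : ℂ)) volume :=
    hc.aestronglyMeasurable
  have hmem : MemLp (fun x : Pos M => ((x m : ℝ) : ℂ) • modulusWave t ψ x) 2 volume :=
    (Lp.memLp φ).mono (hm.smul (Lp.memLp (modulusWave t ψ)).1) hle
  refine ⟨hmem.toLp _, hmem.coeFn_toLp, Lp.norm_le_norm_of_ae_le ?_⟩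
  filter_upwards [hle, hmem.coeFn_toLp] with x h1 h2
  rwa [h2]

theorem coeFn_component (α : SpinIdx N) (ψ : Hilb M N) :
    component α ψ =ᵐ[volume] fun x => EuclideanSpace.single α (ψ x α) := by
  filter_upwards [coeFn_spinOp (Matrix.diagonal (Pi.single α 1)) ψ] with x hx
  rw [component, hx]
  ext β
  rw [toEuclideanCLM_diagonal]
  by_cases h : β = α
  · subst h; simp
  · simp [h]

theorem weight_modulusWave (t : Fin N → ℝ) (ψ : Hilb M N) :
    weight (modulusWave t ψ) = weight ψ := by
  ext α
  rw [weight, weight, Lp.norm_def, Lp.norm_def]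
  congr 2
  refine eLpNorm_congr_norm_ae ?_
  filter_upwards [coeFn_component α (modulusWave t ψ), coeFn_component α ψ,
    coeFn_modulusWave t ψ] with x h1 h2 h3
  rw [h1, h2, h3]
  simp [norm_modulus_apply]

theorem modulusWave_mem_formDomain (t : Fin N → ℝ) {ψ : Hilb M N} (h : ψ ∈ formDomain M N) :
    modulusWave t ψ ∈ formDomain M N :=
  mem_formDomain_of fun m =>
    ⟨(exists_isWeakPartial_modulusWave t (isWeakPartial_partialD h m)).imp fun _ h => h.1,
      (exists_isPosition_modulusWave t (isPosition_position h m)).imp fun _ h => h.1⟩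

/-- First moments depend on ψ only through the densities |ψ_α|². -/
theorem moment_modulusWave (t : Fin N → ℝ) {ψ : Hilb M N} (h : ψ ∈ formDomain M N) :
    moment (modulusWave t ψ) = moment ψ := by
  have key : ∀ (χ : Hilb M N), χ ∈ formDomain M N → ∀ α m,
      (inner ℂ (component α χ) (component α (position m χ)) : ℂ) =
        ∫ x : Pos M, ((x m * ‖χ x α‖ ^ 2 : ℝ) : ℂ) := by
    intro χ hχ α m
    rw [L2.inner_def]
    apply integral_congr_ae
    have hX := isPosition_position hχ m
    unfold IsPosition at hX
    filter_upwards [coeFn_component α χ, coeFn_component α (position m χ), hX] with x h1 h2 h3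
    rw [h1, h2, h3]
    simp only [EuclideanSpace.inner_single_left, PiLp.smul_apply, smul_eq_mul,
      PiLp.single_apply, if_true]
    rw [mul_left_comm, Complex.conj_mul']
    push_cast
    rfl
  ext α m
  rw [moment, moment, key _ h, key _ (modulusWave_mem_formDomain t h)]
  congr 1
  apply integral_congr_ae
  filter_upwards [coeFn_modulusWave t ψ] with x hx
  rw [hx, norm_modulus_apply]

theorem toEuclideanCLM_tSigmaX (t : Fin N → ℝ) (c : Spin N) (α : SpinIdx N) :
    Matrix.toEuclideanCLM (𝕜 := ℂ) (∑ n, (t n : ℂ) • liftMatrix pauliX n) c α =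
      ∑ n, (t n : ℂ) * c (flipSpin n α) := by
  rw [map_sum, sum_apply, WithLp.ofLp_sum, Finset.sum_apply]
  refine Finset.sum_congr rfl fun n _ => ?_
  rw [map_smul, smul_apply, PiLp.smul_apply, toEuclideanCLM_liftMatrix_pauliX, smul_eq_mul]

/-- Pointwise, each term coupling α to its n-th flip has real part at most |t n| times the two
moduli, and the choice of signs attains this bound for every term at once. -/
theorem re_inner_tSigmaX_le (t : Fin N → ℝ) (ψ : Hilb M N) :
    (inner ℂ ψ (tSigmaX t ψ) : ℂ).re ≤
      (inner ℂ (modulusWave t ψ) (tSigmaX t (modulusWave t ψ)) : ℂ).re := by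
  have hre : ∀ φ χ : Hilb M N, (inner ℂ φ χ : ℂ).re = ∫ x, (inner ℂ (φ x) (χ x) : ℂ).re := by
    intro φ χ
    rw [L2.inner_def]
    exact (integral_re (L2.integrable_inner (𝕜 := ℂ) φ χ)).symm
  have hint : ∀ φ χ : Hilb M N, Integrable fun x => (inner ℂ (φ x) (χ x) : ℂ).re :=
    fun φ χ => (L2.integrable_inner (𝕜 := ℂ) φ χ).re
  rw [hre, hre, tSigmaX_eq]
  refine integral_mono_ae (hint _ _) (hint _ _) ?_
  filter_upwards [coeFn_spinOp (∑ n, (t n : ℂ) • liftMatrix pauliX n) ψ,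
    coeFn_spinOp (∑ n, (t n : ℂ) • liftMatrix pauliX n) (modulusWave t ψ),
    coeFn_modulusWave t ψ] with x h1 h2 h3
  rw [h1, h2, h3]
  simp only [PiLp.inner_apply, toEuclideanCLM_tSigmaX, RCLike.inner_apply, Complex.re_sum,
    Finset.sum_mul]
  refine Finset.sum_le_sum fun α _ => Finset.sum_le_sum fun n _ => ?_
  have e : ((t n : ℂ) * modulus t (ψ x) (flipSpin n α) *
      (starRingEnd ℂ) (modulus t (ψ x) α)) =
      ((|t n| * (‖ψ x α‖ * ‖ψ x (flipSpin n α)‖) : ℝ) : ℂ) := by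
    rw [modulus_apply, modulus_apply, Complex.conj_ofReal, ← Complex.ofReal_mul,
      ← Complex.ofReal_mul, ← mul_componentSign_mul_flipSpin t n α]
    congr 1
    ring
  rw [e, Complex.ofReal_re]
  refine (Complex.re_le_norm _).trans_eq ?_
  rw [norm_mul, norm_mul, Complex.norm_real, Complex.norm_conj, Real.norm_eq_abs]
  ring

theorem modulusWave_mem_constraintSet (t : Fin N → ℝ) {σ : Fin N → ℝ} {ξ : Fin M → ℝ}
    {ψ : Hilb M N} (h : ψ ∈ constraintSet σ ξ) : modulusWave t ψ ∈ constraintSet σ ξ := by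
  obtain ⟨h1, h2, h3, h4⟩ := h
  refine ⟨modulusWave_mem_formDomain t h1, ?_, ?_, ?_⟩
  · rw [← h2, ← sq_eq_sq₀ (norm_nonneg _) (norm_nonneg _), ← sum_weight, ← sum_weight,
      weight_modulusWave]
  · rw [← h3]
    ext n
    simp only [magnetization_apply, weight_modulusWave]
  · rw [← h4]
    ext m
    simp only [displacement_apply, moment_modulusWave t h1]

theorem energy_modulusWave_le (Λ : Matrix (Fin M) (Fin N) ℝ) (t : Fin N → ℝ) {ψ : Hilb M N}
    (h : ψ ∈ formDomain M N) : energy Λ t (modulusWave t ψ) ≤ energy Λ t ψ := by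
  have h1 : gradNormSq (modulusWave t ψ) ≤ gradNormSq ψ := by
    refine Finset.sum_le_sum fun m _ => ?_
    obtain ⟨φ, e1, e2⟩ := exists_isWeakPartial_modulusWave t (isWeakPartial_partialD h m)
    rw [partialD_eq e1]
    gcongr
  have h2 : posNormSq (modulusWave t ψ) ≤ posNormSq ψ := by
    refine Finset.sum_le_sum fun m _ => ?_
    obtain ⟨φ, e1, e2⟩ := exists_isPosition_modulusWave t (isPosition_position h m)
    rw [position_eq e1]
    gcongr
  have h3 := re_inner_tSigmaX_le t ψ
  rw [energy, energy, inner_coupling Λ h, inner_coupling Λ (modulusWave_mem_formDomain t h),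
    moment_modulusWave t h]
  linarith

theorem IsOptimizer.modulusWave {Λ : Matrix (Fin M) (Fin N) ℝ} {t : Fin N → ℝ} {σ : Fin N → ℝ}
    {ξ : Fin M → ℝ} {ψ : Hilb M N} (h : IsOptimizer Λ t σ ξ ψ) :
    IsOptimizer Λ t σ ξ (modulusWave t ψ) :=
  ⟨modulusWave_mem_constraintSet t h.1, fun φ hφ =>
    (energy_modulusWave_le Λ t h.1.1).trans (h.2 φ hφ)⟩

end ModulusWave

/-! ### A trial state satisfying the constraints -/

section TrialState

/-- The probability of the spin configuration `α` in the product state of magnetization `σ`. -/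
def productWeight (σ : Fin N → ℝ) (α : SpinIdx N) : ℝ :=
  ∏ n, (1 + spinSign (α n) * σ n) / 2

theorem productWeight_nonneg {σ : Fin N → ℝ} (hσ : ∀ n, σ n ∈ Set.Icc (-1 : ℝ) 1)
    (α : SpinIdx N) : 0 ≤ productWeight σ α := by
  refine Finset.prod_nonneg fun n _ => ?_
  obtain ⟨h1, h2⟩ := hσ n
  unfold spinSign
  split_ifs <;> linarith

theorem sum_productWeight (σ : Fin N → ℝ) : ∑ α, productWeight σ α = 1 := by
  have h := Finset.prod_univ_sum (fun _ : Fin N => (Finset.univ : Finset (Fin 2)))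
    (fun n i => (1 + spinSign i * σ n) / 2)
  rw [Fintype.piFinset_univ] at h
  unfold productWeight
  rw [← h]
  refine Finset.prod_eq_one fun n _ => ?_
  simp [spinSign]
  ring

theorem sum_spinSign_mul_productWeight (σ : Fin N → ℝ) (k : Fin N) :
    ∑ α, spinSign (α k) * productWeight σ α = σ k := by
  have h := Finset.prod_univ_sum (fun _ : Fin N => (Finset.univ : Finset (Fin 2)))
    -- Placing the sign inside the factor at site k keeps the sum factorized: site k contributes σ
    -- k, every other site 1.
    (fun n i => (if n = k then spinSign i else 1) * ((1 + spinSign i * σ n) / 2))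
  rw [Fintype.piFinset_univ] at h
  have e : ∀ α : SpinIdx N, spinSign (α k) * productWeight σ α =
      ∏ n, (if n = k then spinSign (α n) else 1) * ((1 + spinSign (α n) * σ n) / 2) := by
    intro α
    rw [Finset.prod_mul_distrib, Finset.prod_ite_eq' Finset.univ k fun n => spinSign (α n)]
    simp [productWeight]
  simp only [e]
  rw [← h, Finset.prod_eq_single k]
  · simp [spinSign]
    ring
  · intro n _ hn
    simp [spinSign, hn]
    ring
  · simp

theorem toLp_mem_formDomain (f : 𝓢(Pos M, Spin N)) : f.toLp 2 volume ∈ formDomain M N := by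
  refine mem_formDomain_of fun m =>
    ⟨⟨(∂_{(EuclideanSpace.single m (1 : ℝ) : Pos M)} f).toLp 2 volume,
    ?_⟩, ?_⟩
  · rw [IsWeakPartial, Lp.toTemperedDistribution_toLp_eq, Lp.toTemperedDistribution_toLp_eq,
      TemperedDistribution.lineDerivOp_toTemperedDistributionCLM_eq]
  · let L : Pos M →L[ℝ] ℂ := Complex.ofRealCLM ∘L (EuclideanSpace.proj m : Pos M →L[ℝ] ℝ)
    have hL : Function.HasTemperateGrowth L := L.hasTemperateGrowth
    refine ⟨(SchwartzMap.smulLeftCLM (Spin N) L f).toLp 2 volume, ?_⟩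
    unfold IsPosition
    filter_upwards [SchwartzMap.coeFn_toLp (SchwartzMap.smulLeftCLM (Spin N) L f) 2 volume,
      f.coeFn_toLp 2 volume] with x h1 h2
    rw [h1, h2, SchwartzMap.smulLeftCLM_apply_apply hL]
    rfl

/-- A scalar bump times the spin vector with amplitudes √`productWeight` has, once normalized, the
weights of independent spins with means σ. The bounds on σ make these weights nonnegative. -/
theorem constraintSet_nonempty {σ : Fin N → ℝ} (hσ : ∀ n, σ n ∈ Set.Icc (-1 : ℝ) 1)
    (ξ : Fin M → ℝ) : (constraintSet σ ξ : Set (Hilb M N)).Nonempty := by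
  let b : ContDiffBump (0 : Pos M) := ⟨1, 2, one_pos, one_lt_two⟩
  let c : Spin N := WithLp.toLp 2 fun α => ((√(productWeight σ α) : ℝ) : ℂ)
  have hsupp : HasCompactSupport fun x : Pos M => b x • c := b.hasCompactSupport.smul_right
  have hdiff : ContDiff ℝ (⊤ : ℕ∞) fun x : Pos M => b x • c := b.contDiff.smul contDiff_const
  let f : 𝓢(Pos M, Spin N) := hsupp.toSchwartzMap hdiff
  let ψ : Hilb M N := f.toLp 2 volume
  have hf : ψ =ᵐ[volume] fun x => b x • c := f.coeFn_toLp 2 volume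
  have hw : ∀ α, weight ψ α = productWeight σ α * ∫ x, b x ^ 2 := by
    intro α
    have h1 := inner_self_eq_norm_sq_to_K (𝕜 := ℂ) (component α ψ)
    rw [L2.inner_def] at h1
    have h2 : ∫ x, (inner ℂ (component α ψ x) (component α ψ x) : ℂ) =
        ∫ x, ((productWeight σ α * b x ^ 2 : ℝ) : ℂ) := by
      apply integral_congr_ae
      filter_upwards [coeFn_component α ψ, hf] with x h3 h4
      rw [h3, h4, inner_self_eq_norm_sq_to_K, PiLp.norm_single]
      have : ‖(b x • c) α‖ ^ 2 = productWeight σ α * b x ^ 2 := by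
        rw [PiLp.smul_apply, norm_smul, mul_pow, Complex.norm_real, Real.norm_eq_abs, sq_abs,
          Real.norm_eq_abs, sq_abs, Real.sq_sqrt (productWeight_nonneg hσ α), mul_comm]
      rw [← this, Complex.ofReal_pow]
      rfl
    rw [h2, integral_complex_ofReal, integral_const_mul] at h1
    have h3 : ((productWeight σ α * ∫ x, b x ^ 2 : ℝ) : ℂ) = ((weight ψ α : ℝ) : ℂ) := by
      rw [h1, weight, Complex.ofReal_pow]
      rfl
    exact (Complex.ofReal_injective h3).symm
  have hpos : 0 < ∫ x, b x ^ 2 := by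
    have hc : Continuous fun x => b x ^ 2 := b.continuous.pow 2
    refine hc.integral_pos_of_hasCompactSupport_nonneg_nonzero
      (b.hasCompactSupport.comp_left (g := fun y : ℝ => y ^ 2) (by simp)) (fun x => sq_nonneg _)
      (x := 0) ?_
    have : b (0 : Pos M) = 1 := b.one_of_mem_closedBall (by simp [b])
    simp [this]
  set I := ∫ x, b x ^ 2 with hI
  have hnorm : ‖ψ‖ ^ 2 = I := by
    rw [← sum_weight]
    simp only [hw]
    rw [← Finset.sum_mul, sum_productWeight, one_mul]
  let ψ₁ : Hilb M N := ((√I)⁻¹ : ℂ) • ψ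
  have hψ := toLp_mem_formDomain f
  have hψ₁ : ψ₁ ∈ formDomain M N := mem_formDomain_of fun m =>
    ⟨⟨_, IsWeakDeriv.const_smul (isWeakPartial_partialD hψ m) _⟩,
      ⟨_, (isPosition_position hψ m).const_smul _⟩⟩
  have hw₁ : ∀ α, weight ψ₁ α = productWeight σ α := by
    intro α
    have : weight ψ₁ α = I⁻¹ * weight ψ α := by
      rw [weight, weight, map_smul, norm_smul, mul_pow]
      congr 1
      rw [norm_inv, Complex.norm_real, Real.norm_eq_abs, inv_pow, sq_abs, Real.sq_sqrt hpos.le]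
    rw [this, hw]
    field_simp
  have hmem : ψ₁ ∈ constraintSet σ (displacement ψ₁) := by
    refine ⟨hψ₁, ?_, ?_, rfl⟩
    · have := sum_weight ψ₁
      simp only [hw₁, sum_productWeight] at this
      nlinarith [norm_nonneg ψ₁]
    · ext n
      simp only [magnetization_apply, hw₁, sum_spinSign_mul_productWeight]
  -- The displacement of the trial state need not be computed: a translation corrects it without
  -- touching the magnetization.
  have := translate_mem_constraintSet hmem (WithLp.toLp 2 (ξ - displacement ψ₁))
  simp only [add_sub_cancel] at this
  exact ⟨_, this⟩

end TrialState

end Dicke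

end

/-! ### Assembly -/

open Dicke

theorem theorem3p6 {M N : ℕ} (Λ : Matrix (Fin M) (Fin N) ℝ) (t : Fin N → ℝ) (ht : t ≠ 0)
    (σ : Fin N → ℝ) (hσ : ∀ n, σ n ∈ Set.Icc (-1 : ℝ) 1) (ξ : Fin M → ℝ) :
    -- displacement rule
    (∀ ζ : Fin M → ℝ,
      FLL Λ t σ (ξ + ζ) =
        FLL Λ t σ ξ + 2 * (ζ ⬝ᵥ ξ) + ζ ⬝ᵥ (Matrix.mulVec Λ σ) + ζ ⬝ᵥ ζ) ∧
    FLL Λ t σ ξ = FLL Λ t σ 0 + ξ ⬝ᵥ (Matrix.mulVec Λ σ) + ξ ⬝ᵥ ξ ∧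
    -- a real-valued optimizer exists
    (∃ ψ : Hilb M N, IsOptimizer Λ t σ ξ ψ ∧ IsRealValued ψ) ∧
    -- virial relation
    (∀ ψ : Hilb M N, IsOptimizer Λ t σ 0 ψ →
      ((gradNormSq ψ - posNormSq ψ : ℝ) : ℂ) = (1 / 2 : ℂ) * inner ℂ ψ (coupling Λ ψ)) ∧
    -- identity for real-valued optimizers
    (∀ ψ : Hilb M N, IsOptimizer Λ t σ ξ ψ → IsRealValued ψ →
      inner ℂ ψ (coupling Λ ψ) =
        ((ξ ⬝ᵥ (Matrix.mulVec Λ σ) - 1 / 2 * lamSigmaZNormSq Λ ψ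
          + 1 / 2 * ((Matrix.mulVec Λ σ) ⬝ᵥ (Matrix.mulVec Λ σ)) : ℝ) : ℂ)
        - inner ℂ (tSigmaX t ψ) (divLamSigma Λ σ ψ)) := by
  have hex : ∀ ξ : Fin M → ℝ, ∃ ψ : Hilb M N, IsOptimizer Λ t σ ξ ψ := fun ξ =>
    exists_isOptimizer Λ t (constraintSet_nonempty hσ ξ)
  obtain ⟨ψ, hψ⟩ := hex ξ
  obtain ⟨ψ₀, hψ₀⟩ := hex 0
  refine ⟨fun ζ => FLL_add hψ ζ, ?_, ⟨_, hψ.modulusWave, isRealValued_modulusWave t ψ⟩,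
    fun φ hφ => hφ.virial, fun φ hφ hreal => hφ.coupling_eq hreal⟩
  simpa using FLL_add hψ₀ ξ
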